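/- Let $K=\{0,a,b,c\}\cong \mathbb Z_2\times\mathbb Z_2$ be the Kleinian four-group, with the symmetric bilinear dot product $K\times K\to\mathbb F_2$ for which $x\cdot y=1$ if $x,y$ are distinct and both nonzero, and $x\cdot y=0$ otherwise. A code of length $n\ge 1$ is a subgroup $C\le K^n$; it is self-dual if $C=C^\perp$ for the scalar product $(\mathbf x,\mathbf y)=\sum_i x_i\cdot y_i$. Its weight enumerator is $W_C(u,v)=\sum_{\mathbf x\in C}u^{n-\mathrm{wt}(\mathbf x)}v^{\mathrm{wt}(\mathbf x)}$, where $\mathrm{wt}(\mathbf x)$ is the number of nonzero entries of $\mathbf x$. Two codes of length $n$ are equivalent if one is carried to the other by a permutation of the positions together with a permutation of the symbols $a,b,c$ at each position; codes of different lengths are inequivalent. Put $m=\lfloor n/2\rfloor$. There are unique integers $a_0,\dots,a_m$ for which $$\sum_{i=0}^{m}a_i\,(u+v)^{n-2i}\bigl(v(u-v)\bigr)^i$$ has the form $u^n+0\cdot u^{n-1}v+\cdots+0\cdot u^{n-m}v^m+A_{m+1}u^{n-m-1}v^{m+1}+\cdots+A_nv^n$. This polynomial is called the extremal weight enumerator of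 length $n$, and a self-dual code of length $n$ whose weight enumerator equals it is called extremal. Theorem. Up to equivalence there are exactly five extremal codes of length $n\ge1$, namely the following pairwise inequivalent codes: * $\gamma_1=\{(0),(a)\}$ of length $1$; * $\epsilon_2=\{(00),(aa),(bb),(cc)\}$ of length $2$; * $\delta_3^+=\{(000),(aa0),(a0a),(0aa),(bbb),(ccb),(cbc),(bcc)\}$ of length $3$; * the shorter Hexacode $\mathcal C_5=\{(x_1,\dots,x_5): (x_1,\dots,x_5,z)\in\mathcal C_6 \text{ for some } z\in\{0,a\}\}$ of length $5$; * the Hexacode $\mathcal C_6$ of length $6$, spanned by $(a0a0bb)$, $(a0bba0)$, $(bba0a0)$, $(00aaaa)$, $(aa00aa)$, $(b0b0ca)$. -/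

import Mathlib

namespace Kleinian

/-- The Kleinian four-group `K ≅ ℤ/2 × ℤ/2`. -/
abbrev K : Type := ZMod 2 × ZMod 2

namespace K

/-- The nonzero element `a` of `K`. -/
def a : K := (1, 0)

/-- The nonzero element `b` of `K`. -/
def b : K := (0, 1)

/-- The nonzero element `c` of `K`. -/
def c : K := (1, 1)

/-- The symmetric bilinear dot product `K × K → 𝔽₂`. -/
def dot (x y : K) : ZMod 2 := x.1 * y.2 + x.2 * y.1

/-- The elements of `K` are `0`, `a`, `b`, `c`. -/
theorem eq_zero_or (x : K) : x = 0 ∨ x = a ∨ x = b ∨ x = c := by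
  revert x; decide

/-- `dot` is `1` on two distinct nonzero elements, and `0` otherwise. -/
theorem dot_eq (x y : K) : dot x y = if x ≠ 0 ∧ y ≠ 0 ∧ x ≠ y then 1 else 0 := by
  revert x y; decide

end K

open K

/-- The scalar product `(x, y) = ∑ xᵢ · yᵢ` on `Kⁿ`. -/
def scalarProduct {n : ℕ} (x y : Fin n → K) : ZMod 2 := ∑ i, dot (x i) (y i)

/-- A (linear) Kleinian code of length `n`: a subgroup of `Kⁿ`. -/
abbrev Code (n : ℕ) : Type := AddSubgroup (Fin n → K)

/-- The dual code. -/
def dual {n : ℕ} (C : Code n) : Code n where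
  carrier := {x | ∀ y ∈ C, scalarProduct x y = 0}
  zero_mem' := by
    intro y _
    simp [scalarProduct, dot]
  add_mem' := by
    intro x x' hx hx' y hy
    have h1 := hx y hy
    have h2 := hx' y hy
    have h : scalarProduct (x + x') y = scalarProduct x y + scalarProduct x' y := by
      simp only [scalarProduct, dot, ← Finset.sum_add_distrib]
      refine Finset.sum_congr rfl fun i _ => ?_
      simp only [Pi.add_apply, Prod.fst_add, Prod.snd_add]
      ring
    rw [h, h1, h2, add_zero]
  neg_mem' := by
    intro x hx y hy
    have h1 := hx y hy
    have h : scalarProduct (-x) y = - scalarProduct x y := by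
      simp only [scalarProduct, dot, ← Finset.sum_neg_distrib]
      refine Finset.sum_congr rfl fun i _ => ?_
      simp only [Pi.neg_apply, Prod.fst_neg, Prod.snd_neg]
      ring
    rw [h, h1, neg_zero]

/-- `C` is self-dual if `C^⊥ = C`. -/
def IsSelfDual {n : ℕ} (C : Code n) : Prop := dual C = C

/-- Two codes are equivalent if one is the image of the other under a renumbering of the
positions together with an automorphism of `K` (a permutation of `a`, `b`, `c`) at every
position. Codes of different lengths are never equivalent. -/
def Equivalent {n m : ℕ} (C : Code n) (D : Code m) : Prop :=
  ∃ (e : Fin m ≃ Fin n) (σ : Fin m → (K ≃+ K)),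
    ∀ x : Fin n → K, x ∈ C ↔ (fun j => σ j (x (e j))) ∈ D

section WeightEnumerator

open MvPolynomial

/-- The number `Aᵢ` of codewords of weight `i`. -/
noncomputable def weightCount {n : ℕ} (C : Code n) (i : ℕ) : ℕ :=
  {x : Fin n → K | x ∈ C ∧ hammingNorm x = i}.ncard

/-- The Hamming weight enumerator `W_C(u, v) = ∑ᵢ Aᵢ uⁿ⁻ⁱ vⁱ`, where `u = X 0`, `v = X 1`. -/
noncomputable def weightEnumerator {n : ℕ} (C : Code n) : MvPolynomial (Fin 2) ℤ :=
  ∑ i ∈ Finset.range (n + 1), MvPolynomial.C (weightCount C i : ℤ) * X 0 ^ (n - i) * X 1 ^ i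

/-- The polynomial `∑_{i=0}^{⌊n/2⌋} aᵢ (u + v)ⁿ⁻²ⁱ (v (u - v))ⁱ`. -/
noncomputable def gleasonPolynomial (n : ℕ) (a : Fin (n / 2 + 1) → ℤ) : MvPolynomial (Fin 2) ℤ :=
  ∑ i : Fin (n / 2 + 1),
    C (a i) * (X 0 + X 1) ^ (n - 2 * (i : ℕ)) * (X 1 * (X 0 - X 1)) ^ (i : ℕ)

/-- The exponent of the monomial `uⁿ⁻ʲ vʲ`. -/
noncomputable def uvExponent (n j : ℕ) : Fin 2 →₀ ℕ :=
  Finsupp.single 0 (n - j) + Finsupp.single 1 j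

theorem coeff_single_linear_mul (e : ℤ) (k : ℕ) (p : MvPolynomial (Fin 2) ℤ) :
    coeff (Finsupp.single 0 (k + 1)) ((X 0 + C e * X 1) * p) =
      coeff (Finsupp.single 0 k) p := by
  have h0 : (Finsupp.single (0 : Fin 2) (k + 1)) = Finsupp.single 0 1 + Finsupp.single 0 k := by
    rw [← Finsupp.single_add, add_comm]
  have h1 : coeff (Finsupp.single (0 : Fin 2) (k + 1)) (X 1 * p) = 0 := by
    rw [coeff_X_mul', if_neg]
    simp [Finsupp.mem_support_iff]
  rw [add_mul, mul_assoc, coeff_add, coeff_C_mul, h1, mul_zero, add_zero, h0, coeff_X_mul]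

theorem coeff_single_linear_pow_mul (e : ℤ) (k l : ℕ) (p : MvPolynomial (Fin 2) ℤ) :
    coeff (Finsupp.single 0 (k + l)) ((X 0 + C e * X 1) ^ k * p) =
      coeff (Finsupp.single 0 l) p := by
  induction k with
  | zero => simp
  | succ k ih =>
    rw [pow_succ', mul_assoc, show k + 1 + l = (k + l) + 1 by ring, coeff_single_linear_mul, ih]

theorem coeff_gleason_lower (n i j : ℕ) (h : j < i) :
    coeff (uvExponent n j)
      ((X 0 + X 1) ^ (n - 2 * i) * (X 1 * (X 0 - X 1)) ^ i : MvPolynomial (Fin 2) ℤ) = 0 := by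
  have e : ((X 0 + X 1) ^ (n - 2 * i) * (X 1 * (X 0 - X 1)) ^ i : MvPolynomial (Fin 2) ℤ) =
      monomial (Finsupp.single 1 i) 1 * ((X 0 + X 1) ^ (n - 2 * i) * (X 0 - X 1) ^ i) := by
    rw [← X_pow_eq_monomial, mul_pow]; ring
  rw [e, coeff_monomial_mul', if_neg]
  intro hle
  have := hle 1
  simp [uvExponent] at this
  omega

theorem coeff_gleason_diag (n i : ℕ) (h : i ≤ n / 2) :
    coeff (uvExponent n i)
      ((X 0 + X 1) ^ (n - 2 * i) * (X 1 * (X 0 - X 1)) ^ i : MvPolynomial (Fin 2) ℤ) = 1 := by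
  have e : ((X 0 + X 1) ^ (n - 2 * i) * (X 1 * (X 0 - X 1)) ^ i : MvPolynomial (Fin 2) ℤ) =
      monomial (Finsupp.single 1 i) 1 *
        ((X 0 + C 1 * X 1) ^ (n - 2 * i) * ((X 0 + C (-1) * X 1) ^ i * 1)) := by
    rw [← X_pow_eq_monomial, mul_pow, C_neg, C_1]; ring
  have hs : uvExponent n i - Finsupp.single 1 i =
      Finsupp.single 0 ((n - 2 * i) + (i + 0)) := by
    rw [uvExponent, add_tsub_cancel_right]
    congr 1
    omega
  rw [e, coeff_monomial_mul', if_pos (by rw [uvExponent]; exact le_add_self), hs, one_mul,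
    coeff_single_linear_pow_mul, coeff_single_linear_pow_mul]
  simp

/-- There is a unique choice of integers `a₀, …, a_m`, `m = ⌊n/2⌋`, such that
`∑ aᵢ (u + v)ⁿ⁻²ⁱ (v (u - v))ⁱ = uⁿ + 0 uⁿ⁻¹ v + ⋯ + 0 uⁿ⁻ᵐ vᵐ + A_{m+1} uⁿ⁻ᵐ⁻¹ vᵐ⁺¹ + ⋯`. -/
theorem existsUnique_extremalCoeff (n : ℕ) :
    ∃! a : Fin (n / 2 + 1) → ℤ, ∀ j : ℕ, j ≤ n / 2 →
      coeff (uvExponent n j) (gleasonPolynomial n a) = if j = 0 then 1 else 0 := by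
  classical
  let M : Matrix (Fin (n / 2 + 1)) (Fin (n / 2 + 1)) ℤ := Matrix.of fun j i =>
    coeff (uvExponent n j)
      ((X 0 + X 1) ^ (n - 2 * (i : ℕ)) * (X 1 * (X 0 - X 1)) ^ (i : ℕ) : MvPolynomial (Fin 2) ℤ)
  have hdet : M.det = 1 := by
    rw [Matrix.det_of_isLowerTriangular M (fun j i hji => coeff_gleason_lower n i j hji)]
    exact Finset.prod_eq_one fun i _ => coeff_gleason_diag n i (by have := i.2; omega)
  have hu : IsUnit M.det := by rw [hdet]; exact isUnit_one
  have hc : ∀ (a : Fin (n / 2 + 1) → ℤ) (j : Fin (n / 2 + 1)),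
      coeff (uvExponent n j) (gleasonPolynomial n a) = M.mulVec a j := by
    intro a j
    simp only [gleasonPolynomial, coeff_sum, Matrix.mulVec, dotProduct, mul_assoc, coeff_C_mul]
    exact Finset.sum_congr rfl fun i _ => mul_comm _ _
  let t : Fin (n / 2 + 1) → ℤ := fun j => if (j : ℕ) = 0 then 1 else 0
  have hiff : ∀ a : Fin (n / 2 + 1) → ℤ, (∀ j : ℕ, j ≤ n / 2 →
      coeff (uvExponent n j) (gleasonPolynomial n a) = if j = 0 then 1 else 0) ↔
      M.mulVec a = t := by
    intro a
    constructor
    · intro h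
      funext j
      rw [← hc]
      exact h j (by have := j.2; omega)
    · intro h j hj
      have := congrFun h ⟨j, by omega⟩
      rw [← hc] at this
      exact this
  refine ⟨M⁻¹.mulVec t, ?_, ?_⟩
  · refine (hiff _).2 ?_
    rw [Matrix.mulVec_mulVec, Matrix.mul_nonsing_inv _ hu, Matrix.one_mulVec]
  · intro a ha
    rw [← (hiff a).1 ha, Matrix.mulVec_mulVec, Matrix.nonsing_inv_mul _ hu, Matrix.one_mulVec]

/-- The unique integers of `existsUnique_extremalCoeff`. -/
noncomputable def extremalCoeff (n : ℕ) : Fin (n / 2 + 1) → ℤ :=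
  (existsUnique_extremalCoeff n).choose

/-- The extremal weight enumerator of length `n`. -/
noncomputable def extremalWeightEnumerator (n : ℕ) : MvPolynomial (Fin 2) ℤ :=
  gleasonPolynomial n (extremalCoeff n)

/-- An extremal code: a self-dual code with the extremal weight enumerator. -/
def IsExtremal {n : ℕ} (C : Code n) : Prop :=
  IsSelfDual C ∧ weightEnumerator C = extremalWeightEnumerator n

end WeightEnumerator

/-- The code `γ₁ = {(0), (a)}`. -/
def gamma1 : Code 1 where
  carrier := {![0], ![a]}
  zero_mem' := by decide
  add_mem' := by
    rintro x y (rfl | rfl) (rfl | rfl) <;> simp <;> decide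
  neg_mem' := by
    rintro x (rfl | rfl) <;> simp <;> decide

/-- The code `ε₂ = {(00), (aa), (bb), (cc)}`. -/
def epsilon2 : Code 2 where
  carrier := {![0, 0], ![a, a], ![b, b], ![c, c]}
  zero_mem' := by decide
  add_mem' := by
    rintro x y (rfl | rfl | rfl | rfl) (rfl | rfl | rfl | rfl) <;> simp <;> decide
  neg_mem' := by
    rintro x (rfl | rfl | rfl | rfl) <;> simp <;> decide

/-- The code `δ₃⁺ = δ₃ ∪ (δ₃ + (bbb))`, where `δ₃` consists of the words in `0` and `a` with an
even number of `a`'s. -/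
def delta3Plus : Code 3 where
  carrier := {![0, 0, 0], ![a, a, 0], ![a, 0, a], ![0, a, a],
    ![b, b, b], ![c, c, b], ![c, b, c], ![b, c, c]}
  zero_mem' := by decide
  add_mem' := by
    rintro x y (rfl | rfl | rfl | rfl | rfl | rfl | rfl | rfl)
      (rfl | rfl | rfl | rfl | rfl | rfl | rfl | rfl) <;> simp <;> decide
  neg_mem' := by
    rintro x (rfl | rfl | rfl | rfl | rfl | rfl | rfl | rfl) <;> simp <;> decide

/-- The Hexacode `C₆`. -/
def hexacode : Code 6 :=
  AddSubgroup.closure {![a, 0, a, 0, b, b], ![a, 0, b, b, a, 0], ![b, b, a, 0, a, 0],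
    ![0, 0, a, a, a, a], ![a, a, 0, 0, a, a], ![b, 0, b, 0, c, a]}

/-- Deletion of the last position, as a homomorphism. -/
def deleteLast (n : ℕ) : (Fin (n + 1) → K) →+ (Fin n → K) where
  toFun x i := x i.castSucc
  map_zero' := rfl
  map_add' _ _ := rfl

/-- The code of length `n` obtained from a code of length `n + 1` by taking the codewords whose
last entry is `0` or `z` and deleting that entry. -/
def child {n : ℕ} (C : Code (n + 1)) (z : K) : Code n :=
  (C ⊓ (AddSubgroup.zmultiples z).comap (Pi.evalAddMonoidHom (fun _ => K) (Fin.last n))).map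
    (deleteLast n)

/-- The shorter Hexacode `C₅`. -/
def shorterHexacode : Code 5 := child hexacode a

end Kleinian

/-! An extremal code is self-dual, has order `2 ^ n`, and has minimum weight greater than `m =
⌊n/2⌋` (`IsExtremal.isOptimal`). Since the dual code has the same minimum weight, any entries
prescribed on at most `m` positions are realised by a codeword (`IsOptimal.exists_agree`). So the
codewords supported in a small set `T` can be counted exactly (`IsOptimal.card_shorten_mul`), and
those two facts bound the length.

For `n = 2m`, take the codewords supported in `m + 1` positions: two of them with distinct nonzero
entries at one position have distinct nonzero entries at all `m + 1`, so orthogonality makes `m`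
odd. On `m + 2` positions, comparing `m + 1` codewords at one further position gives `m + 1 ≤ |K| =
4`. Hence `n` is 2 or 6.

For `n = 2m + 1`, weight parity is additive on a self-dual code. The extremal enumerator vanishes at
`(1, -1)`, so some codeword has odd weight, and `even_of_even` then forces one supported in only `m
+ 2` positions. There are 8 codewords there, half of them odd, and exactly `m + 2` nonzero ones
having a zero in `T`; comparing the counts gives `m ≤ 2`. Hence `n` is 1, 3 or 5.

In each length, codewords of small support are chosen, symbol permutations normalise some of their
entries, and orthogonality determines the others, up to one symmetry in length 6. The result is a
fixed basis, and equality of orders finishes. The five codes are inequivalent because their lengths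
differ. -/

namespace Kleinian

open K

/-! ### Explicit bases of the five codes -/

/-- The `𝔽₂`-linear combinations of a finite family of words. -/
def encode {k n : ℕ} (g : Fin k → Fin n → K) : (Fin k → ZMod 2) →+ (Fin n → K) where
  toFun c j := ∑ i, c i • g i j
  map_zero' := by ext j <;> simp
  map_add' c d := by
    funext j
    simp only [Pi.add_apply, add_smul, Finset.sum_add_distrib]

theorem encode_single {k n : ℕ} (g : Fin k → Fin n → K) (i : Fin k) :
    encode g (Pi.single i 1) = g i := by
  funext j
  simp [encode, Pi.single_apply, Finset.sum_ite_eq']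

theorem range_encode_le {k n : ℕ} {g : Fin k → Fin n → K} {C : Code n} (h : ∀ i, g i ∈ C) :
    (encode g).range ≤ C := by
  rintro _ ⟨c, rfl⟩
  have : encode g c = ∑ i, c i • g i := by
    funext j
    simp [encode, Finset.sum_apply]
  rw [this]
  refine sum_mem fun i _ => ?_
  rcases (by decide : ∀ t : ZMod 2, t = 0 ∨ t = 1) (c i) with h0 | h0 <;> simp [h0, h i]

theorem card_range_encode {k n : ℕ} {g : Fin k → Fin n → K} (h : Function.Injective (encode g)) :
    Nat.card (encode g).range = 2 ^ k := by
  have := Nat.card_range_of_injective h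
  rw [Nat.card_eq_fintype_card (α := Fin k → ZMod 2), Fintype.card_fun, ZMod.card,
    Fintype.card_fin] at this
  exact this

theorem weightCount_range_encode {k n : ℕ} {g : Fin k → Fin n → K}
    (h : Function.Injective (encode g)) (i : ℕ) :
    weightCount (encode g).range i =
      (Finset.univ.filter fun c => hammingNorm (encode g c) = i).card := by
  have : {x : Fin n → K | x ∈ (encode g).range ∧ hammingNorm x = i} =
      encode g '' (Finset.univ.filter fun c => hammingNorm (encode g c) = i : Finset _) := by
    ext x
    constructor
    · rintro ⟨⟨c, rfl⟩, hc⟩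
      exact ⟨c, by simpa using hc, rfl⟩
    · rintro ⟨c, hc, rfl⟩
      exact ⟨⟨c, rfl⟩, by simpa using hc⟩
  rw [weightCount, this, Set.ncard_image_of_injective _ h, Set.ncard_coe_finset]

/-- A basis of the Hexacode. -/
def hexacodeBasis : Fin 6 → Fin 6 → K :=
  ![![a, 0, 0, a, c, c], ![b, 0, 0, c, a, b], ![0, a, 0, a, b, b], ![0, c, 0, c, c, a],
    ![0, 0, a, a, a, a], ![0, 0, b, c, b, c]]

/-- A basis of the shorter Hexacode. -/
def shorterHexacodeBasis : Fin 5 → Fin 5 → K :=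
  ![![0, 0, a, a, a], ![c, 0, 0, b, b], ![b, 0, b, 0, c], ![0, c, 0, c, c], ![0, b, c, 0, b]]

theorem encode_hexacodeBasis_injective : Function.Injective (encode hexacodeBasis) := by
  rw [injective_iff_map_eq_zero]
  decide +kernel

theorem encode_shorterHexacodeBasis_injective :
    Function.Injective (encode shorterHexacodeBasis) := by
  rw [injective_iff_map_eq_zero]
  decide +kernel

theorem mem_zmultiples_a (x : K) : x ∈ AddSubgroup.zmultiples a ↔ x = 0 ∨ x = a := by
  constructor
  · rintro ⟨k, rfl⟩
    rcases Int.even_or_odd' k with ⟨l, rfl | rfl⟩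
    · left
      change (2 * l) • a = 0
      rw [mul_comm, mul_smul, show (2 : ℤ) • a = 0 by decide, smul_zero]
    · right
      change (2 * l + 1) • a = a
      rw [add_smul, mul_comm, mul_smul, show (2 : ℤ) • a = 0 by decide, smul_zero, zero_add,
        one_smul]
  · rintro (rfl | rfl)
    · exact zero_mem _
    · exact AddSubgroup.mem_zmultiples a

theorem hexacode_eq_range : hexacode = (encode hexacodeBasis).range := by
  apply le_antisymm
  · refine (AddSubgroup.closure_le _).2 ?_
    have h : ∀ i, ∃ d, encode hexacodeBasis d = (![![a, 0, a, 0, b, b], ![a, 0, b, b, a, 0],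
        ![b, b, a, 0, a, 0], ![0, 0, a, a, a, a], ![a, a, 0, 0, a, a],
        ![b, 0, b, 0, c, a]] : Fin 6 → Fin 6 → K) i := by
      decide +kernel
    rintro x (rfl | rfl | rfl | rfl | rfl | rfl)
    exacts [h 0, h 1, h 2, h 3, h 4, h 5]
  · refine range_encode_le fun i => ?_
    let G : Fin 6 → Fin 6 → K := ![![a, 0, a, 0, b, b], ![a, 0, b, b, a, 0],
        ![b, b, a, 0, a, 0], ![0, 0, a, a, a, a], ![a, a, 0, 0, a, a], ![b, 0, b, 0, c, a]]
    have hG : (encode G).range ≤ hexacode := by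
      refine range_encode_le fun i => AddSubgroup.subset_closure ?_
      fin_cases i <;> simp [G]
    have h : ∀ i, ∃ d, encode (![![a, 0, a, 0, b, b], ![a, 0, b, b, a, 0],
        ![b, b, a, 0, a, 0], ![0, 0, a, a, a, a], ![a, a, 0, 0, a, a],
        ![b, 0, b, 0, c, a]] : Fin 6 → Fin 6 → K) d = hexacodeBasis i := by
      decide +kernel
    exact hG (h i)

theorem shorterHexacode_eq_range : shorterHexacode = (encode shorterHexacodeBasis).range := by
  apply le_antisymm
  · rintro _ ⟨y, ⟨hy, hz⟩, rfl⟩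
    rw [SetLike.mem_coe, hexacode_eq_range] at hy
    obtain ⟨c, rfl⟩ := hy
    have h : ∀ c, encode hexacodeBasis c (Fin.last 5) = 0 ∨
        encode hexacodeBasis c (Fin.last 5) = a →
        ∃ d, encode shorterHexacodeBasis d = deleteLast 5 (encode hexacodeBasis c) := by
      decide +kernel
    exact h c ((mem_zmultiples_a _).1 hz)
  · refine range_encode_le fun i => ?_
    have h : ∀ i, ∃ c, (encode hexacodeBasis c (Fin.last 5) = 0 ∨
        encode hexacodeBasis c (Fin.last 5) = a) ∧
        deleteLast 5 (encode hexacodeBasis c) = shorterHexacodeBasis i := by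
      decide +kernel
    obtain ⟨c, hc, hi⟩ := h i
    refine ⟨encode hexacodeBasis c, ⟨?_, (mem_zmultiples_a _).2 hc⟩, hi⟩
    rw [SetLike.mem_coe, hexacode_eq_range]
    exact ⟨c, rfl⟩

theorem gamma1_eq_range : gamma1 = (encode ![![a]]).range := by
  ext x
  have h : ∀ x : Fin 1 → K, (x = ![0] ∨ x = ![a]) ↔ ∃ d, encode ![![a]] d = x := by
    decide +kernel
  exact h x

theorem epsilon2_eq_range : epsilon2 = (encode ![![a, a], ![b, b]]).range := by
  ext x
  have h : ∀ x : Fin 2 → K, (x = ![0, 0] ∨ x = ![a, a] ∨ x = ![b, b] ∨ x = ![c, c]) ↔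
      ∃ d, encode ![![a, a], ![b, b]] d = x := by
    decide +kernel
  exact h x

theorem delta3Plus_eq_range :
    delta3Plus = (encode ![![a, a, 0], ![a, 0, a], ![b, b, b]]).range := by
  ext x
  have h : ∀ x : Fin 3 → K, (x = ![0, 0, 0] ∨ x = ![a, a, 0] ∨ x = ![a, 0, a] ∨ x = ![0, a, a] ∨
      x = ![b, b, b] ∨ x = ![c, c, b] ∨ x = ![c, b, c] ∨ x = ![b, c, c]) ↔
      ∃ d, encode ![![a, a, 0], ![a, 0, a], ![b, b, b]] d = x := by
    decide +kernel
  exact h x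

/-! ### Extremality of the five codes -/

theorem scalarProduct_add_left {n : ℕ} (x x' y : Fin n → K) :
    scalarProduct (x + x') y = scalarProduct x y + scalarProduct x' y := by
  simp only [scalarProduct, dot, ← Finset.sum_add_distrib]
  refine Finset.sum_congr rfl fun i _ => ?_
  simp only [Pi.add_apply, Prod.fst_add, Prod.snd_add]
  ring

theorem scalarProduct_comm {n : ℕ} (x y : Fin n → K) : scalarProduct x y = scalarProduct y x :=
  Finset.sum_congr rfl fun i _ => by simp only [dot]; ring

theorem scalarProduct_add_right {n : ℕ} (x y y' : Fin n → K) :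
    scalarProduct x (y + y') = scalarProduct x y + scalarProduct x y' := by
  rw [scalarProduct_comm, scalarProduct_add_left, scalarProduct_comm y, scalarProduct_comm y']

/-- The scalar product with a fixed word. -/
def scalarProductHom {n : ℕ} (x : Fin n → K) : (Fin n → K) →+ ZMod 2 :=
  AddMonoidHom.mk' (scalarProduct x) (scalarProduct_add_right x)

/-- Orthogonality to a span need only be tested on generators, so both hypotheses become finite
checks for a concrete basis. -/
theorem isSelfDual_range_encode {k n : ℕ} {g : Fin k → Fin n → K}
    (h : ∀ i j, scalarProduct (g i) (g j) = 0)
    (h' : ∀ x, (∀ i, scalarProduct x (g i) = 0) → ∃ d, encode g d = x) :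
    IsSelfDual (encode g).range := by
  apply le_antisymm
  · intro x hx
    refine h' x fun i => hx _ ⟨Pi.single i 1, encode_single g i⟩
  · refine range_encode_le fun i y hy => ?_
    exact range_encode_le (C := (scalarProductHom (g i)).ker) (h i) hy

theorem coeff_weightEnumerator {n : ℕ} (C : Code n) {j : ℕ} (hj : j ≤ n) :
    (weightEnumerator C).coeff (uvExponent n j) = weightCount C j := by
  have e : ∀ i, (MvPolynomial.C (weightCount C i : ℤ) * MvPolynomial.X 0 ^ (n - i) *
      MvPolynomial.X 1 ^ i : MvPolynomial (Fin 2) ℤ) =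
      MvPolynomial.monomial (uvExponent n i) (weightCount C i : ℤ) := by
    intro i
    rw [MvPolynomial.X_pow_eq_monomial, MvPolynomial.X_pow_eq_monomial, MvPolynomial.C_mul_monomial,
      MvPolynomial.monomial_mul, uvExponent, mul_one, mul_one]
  simp only [weightEnumerator, e, MvPolynomial.coeff_sum, MvPolynomial.coeff_monomial]
  rw [Finset.sum_eq_single j]
  · simp
  · intro i _ hij
    rw [if_neg]
    intro h
    have := DFunLike.congr_fun h 1
    simp [uvExponent] at this
    exact hij this
  · intro h
    simp at h
    omega

/-- The uniqueness in `existsUnique_extremalCoeff` identifies `α` with `extremalCoeff n`. The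
vectors supplied for `α` below, such as `![1, -6, 3, -8]`, are the solutions of that triangular
system. -/
theorem isExtremal_of_weightEnumerator_eq {n : ℕ} {C : Code n} (hC : IsSelfDual C)
    (α : Fin (n / 2 + 1) → ℤ) (hW : weightEnumerator C = gleasonPolynomial n α)
    (h : ∀ j ≤ n / 2, weightCount C j = if j = 0 then 1 else 0) : IsExtremal C := by
  refine ⟨hC, ?_⟩
  rw [hW, extremalWeightEnumerator]
  congr 1
  refine (existsUnique_extremalCoeff n).unique (fun j hj => ?_)
    (existsUnique_extremalCoeff n).choose_spec.1
  rw [← hW, coeff_weightEnumerator C (by omega), h j hj]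
  split_ifs <;> rfl

theorem isExtremal_gamma1 : IsExtremal gamma1 := by
  have hinj : Function.Injective (encode ![![a]]) := by
    rw [injective_iff_map_eq_zero]
    decide +kernel
  have hw : ∀ i : Fin 2, (Finset.univ.filter fun d => hammingNorm (encode ![![a]] d) = i).card =
      (![1, 1] : Fin 2 → ℕ) i := by decide +kernel
  rw [gamma1_eq_range]
  refine isExtremal_of_weightEnumerator_eq
    (isSelfDual_range_encode (by decide +kernel) (by decide +kernel)) ![1] ?_ ?_
  · have h0 := hw 0
    have h1 := hw 1
    simp only [weightEnumerator, gleasonPolynomial, weightCount_range_encode hinj,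
      Finset.sum_range_succ]
    simp_all
  · intro j hj
    rw [weightCount_range_encode hinj]
    interval_cases j
    exact hw 0

theorem isExtremal_epsilon2 : IsExtremal epsilon2 := by
  have hinj : Function.Injective (encode ![![a, a], ![b, b]]) := by
    rw [injective_iff_map_eq_zero]
    decide +kernel
  have hw : ∀ i : Fin 3, (Finset.univ.filter fun d =>
      hammingNorm (encode ![![a, a], ![b, b]] d) = i).card = (![1, 0, 3] : Fin 3 → ℕ) i := by
    decide +kernel
  rw [epsilon2_eq_range]
  refine isExtremal_of_weightEnumerator_eq
    (isSelfDual_range_encode (by decide +kernel) (by decide +kernel)) ![1, -2] ?_ ?_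
  · simp only [weightEnumerator, gleasonPolynomial, weightCount_range_encode hinj,
      Finset.sum_range_succ, Fin.sum_univ_succ]
    have h0 := hw 0
    have h1 := hw 1
    have h2 := hw 2
    simp_all
    ring
  · intro j hj
    rw [weightCount_range_encode hinj]
    interval_cases j
    exacts [hw 0, hw 1]

theorem isExtremal_delta3Plus : IsExtremal delta3Plus := by
  have hinj : Function.Injective (encode ![![a, a, 0], ![a, 0, a], ![b, b, b]]) := by
    rw [injective_iff_map_eq_zero]
    decide +kernel
  have hw : ∀ i : Fin 4, (Finset.univ.filter fun d =>
      hammingNorm (encode ![![a, a, 0], ![a, 0, a], ![b, b, b]] d) = i).card =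
      (![1, 0, 3, 4] : Fin 4 → ℕ) i := by
    decide +kernel
  rw [delta3Plus_eq_range]
  refine isExtremal_of_weightEnumerator_eq
    (isSelfDual_range_encode (by decide +kernel) (by decide +kernel)) ![1, -3] ?_ ?_
  · simp only [weightEnumerator, gleasonPolynomial, weightCount_range_encode hinj,
      Finset.sum_range_succ, Fin.sum_univ_succ]
    have h0 := hw 0
    have h1 := hw 1
    have h2 := hw 2
    have h3 := hw 3
    simp_all
    ring
  · intro j hj
    rw [weightCount_range_encode hinj]
    interval_cases j
    exacts [hw 0, hw 1]

theorem isExtremal_shorterHexacode : IsExtremal shorterHexacode := by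
  have hinj := encode_shorterHexacodeBasis_injective
  have hw : ∀ i : Fin 6, (Finset.univ.filter fun d =>
      hammingNorm (encode shorterHexacodeBasis d) = i).card =
      (![1, 0, 0, 10, 15, 6] : Fin 6 → ℕ) i := by
    decide +kernel
  rw [shorterHexacode_eq_range]
  refine isExtremal_of_weightEnumerator_eq
    (isSelfDual_range_encode (by decide +kernel) ?_) ![1, -5, 0] ?_ ?_
  -- The exhaustive search runs over a word of length 2 followed by one of length 3, rather than
  -- over words of length 5 directly.
  · have h : ∀ y : Fin 2 → K, ∀ z : Fin 3 → K,
        (∀ i, scalarProduct ![y 0, y 1, z 0, z 1, z 2] (shorterHexacodeBasis i) = 0) →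
        ∃ d, encode shorterHexacodeBasis d = ![y 0, y 1, z 0, z 1, z 2] := by
      decide +kernel
    intro x hx
    have e : x = ![x 0, x 1, x 2, x 3, x 4] := by
      ext i : 1
      fin_cases i <;> rfl
    rw [e] at hx ⊢
    exact h ![x 0, x 1] ![x 2, x 3, x 4] hx
  · simp only [weightEnumerator, gleasonPolynomial, weightCount_range_encode hinj,
      Finset.sum_range_succ, Fin.sum_univ_succ]
    have h0 := hw 0
    have h1 := hw 1
    have h2 := hw 2
    have h3 := hw 3
    have h4 := hw 4
    have h5 := hw 5
    simp_all
    ring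
  · intro j hj
    rw [weightCount_range_encode hinj]
    interval_cases j
    exacts [hw 0, hw 1, hw 2]

theorem isExtremal_hexacode : IsExtremal hexacode := by
  have hinj := encode_hexacodeBasis_injective
  have hw : ∀ i : Fin 7, (Finset.univ.filter fun d =>
      hammingNorm (encode hexacodeBasis d) = i).card =
      (![1, 0, 0, 0, 45, 0, 18] : Fin 7 → ℕ) i := by
    decide +kernel
  rw [hexacode_eq_range]
  refine isExtremal_of_weightEnumerator_eq
    (isSelfDual_range_encode (by decide +kernel) ?_) ![1, -6, 3, -8] ?_ ?_
  · have h : ∀ y z : Fin 3 → K,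
        (∀ i, scalarProduct ![y 0, y 1, y 2, z 0, z 1, z 2] (hexacodeBasis i) = 0) →
        ∃ d, encode hexacodeBasis d = ![y 0, y 1, y 2, z 0, z 1, z 2] := by
      decide +kernel
    intro x hx
    have e : x = ![x 0, x 1, x 2, x 3, x 4, x 5] := by
      ext i : 1
      fin_cases i <;> rfl
    rw [e] at hx ⊢
    exact h ![x 0, x 1, x 2] ![x 3, x 4, x 5] hx
  · simp only [weightEnumerator, gleasonPolynomial, weightCount_range_encode hinj,
      Finset.sum_range_succ, Fin.sum_univ_succ]
    have h0 := hw 0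
    have h1 := hw 1
    have h2 := hw 2
    have h3 := hw 3
    have h4 := hw 4
    have h5 := hw 5
    have h6 := hw 6
    simp_all
    ring
  · intro j hj
    rw [weightCount_range_encode hinj]
    interval_cases j
    exacts [hw 0, hw 1, hw 2, hw 3]

/-! ### What the extremal enumerator implies: minimum weight, order, parity -/

/-- The properties of extremal codes that do not refer to the weight enumerator. -/
structure IsOptimal {n : ℕ} (C : Code n) : Prop where
  selfDual : IsSelfDual C
  lt_norm : ∀ x ∈ C, x ≠ 0 → n / 2 < hammingNorm x
  card : Nat.card C = 2 ^ n

theorem eval_weightEnumerator {n : ℕ} (C : Code n) (s t : ℤ) :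
    MvPolynomial.eval ![s, t] (weightEnumerator C) =
      ∑ i ∈ Finset.range (n + 1), (weightCount C i : ℤ) * s ^ (n - i) * t ^ i := by
  simp [weightEnumerator]

theorem eval_gleasonPolynomial (n : ℕ) (α : Fin (n / 2 + 1) → ℤ) (s t : ℤ) :
    MvPolynomial.eval ![s, t] (gleasonPolynomial n α) =
      ∑ i : Fin (n / 2 + 1), α i * (s + t) ^ (n - 2 * (i : ℕ)) * (t * (s - t)) ^ (i : ℕ) := by
  simp [gleasonPolynomial]

theorem sum_weightCount {n : ℕ} (C : Code n) :
    ∑ i ∈ Finset.range (n + 1), weightCount C i = Nat.card C := by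
  classical
  have h := Finset.card_eq_sum_card_fiberwise (s := Finset.univ.filter fun x => x ∈ C)
    (t := Finset.range (n + 1)) (f := fun x : Fin n → K => hammingNorm x) (by
      intro x _
      have : hammingNorm x ≤ n := by simpa using hammingNorm_le_card_fintype (x := x)
      simpa using Nat.lt_succ_of_le this)
  have hc : Nat.card C = (Finset.univ.filter fun x => x ∈ C).card := by
    rw [Nat.card_eq_fintype_card, Fintype.card_subtype]
  rw [hc, h]
  refine Finset.sum_congr rfl fun i _ => ?_
  rw [weightCount, ← Set.ncard_coe_finset]
  congr 1
  ext x
  simp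

theorem weightCount_zero {n : ℕ} (C : Code n) : weightCount C 0 = 1 := by
  have : {x : Fin n → K | x ∈ C ∧ hammingNorm x = 0} = {0} := by
    ext x
    simp only [hammingNorm_eq_zero, Set.mem_ofPred_eq, Set.mem_singleton_iff, and_iff_right_iff_imp]
    rintro rfl
    exact zero_mem C
  rw [weightCount, this, Set.ncard_singleton]

/-- The vanishing coefficients give the minimum weight. For the order, evaluation at `(1, 0)` shows
that the leading Gleason coefficient is 1, and at `(1, 1)` only that term survives, with value `2 ^
n`. -/
theorem IsExtremal.isOptimal {n : ℕ} {C : Code n} (hC : IsExtremal C) : IsOptimal C := by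
  obtain ⟨hsd, hW⟩ := hC
  have hspec := (existsUnique_extremalCoeff n).choose_spec.1
  refine ⟨hsd, ?_, ?_⟩
  · intro x hx hx0
    by_contra! hle
    have h := hspec _ hle
    change MvPolynomial.coeff _ (extremalWeightEnumerator n) = _ at h
    rw [← hW, coeff_weightEnumerator C (by omega), if_neg (by simpa using hx0)] at h
    have h' : weightCount C (hammingNorm x) = 0 := by exact_mod_cast h
    rw [weightCount, Set.ncard_eq_zero (Set.toFinite _)] at h'
    exact (h' ▸ (⟨hx, rfl⟩ : x ∈ {y : Fin n → K | y ∈ C ∧ hammingNorm y = hammingNorm x}) :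
      x ∈ (∅ : Set (Fin n → K)))
  · have h0 := congrArg (MvPolynomial.eval ![1, 0]) hW
    have h1 := congrArg (MvPolynomial.eval ![1, 1]) hW
    rw [extremalWeightEnumerator, eval_weightEnumerator, eval_gleasonPolynomial] at h0 h1
    rw [Finset.sum_range_succ', Fin.sum_univ_succ] at h0
    rw [Fin.sum_univ_succ] at h1
    simp only [one_pow, mul_one, sub_self, mul_zero] at h1
    simp [weightCount_zero] at h0
    simp [← h0] at h1
    rw [← sum_weightCount]
    have : ((∑ i ∈ Finset.range (n + 1), weightCount C i : ℕ) : ℤ) = (2 ^ n : ℕ) := by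
      push_cast
      exact h1
    exact_mod_cast this

/-- For odd `n` every Gleason term contains a positive power of `u + v`, so the enumerator vanishes
at `(1, -1)`. If all weights were even, its value there would be the order of the code. -/
theorem IsExtremal.exists_odd {n : ℕ} {C : Code n} (hC : IsExtremal C) (hn : Odd n) :
    ∃ x ∈ C, Odd (hammingNorm x) := by
  by_contra! h
  have h1 := congrArg (MvPolynomial.eval ![1, -1]) hC.2
  rw [extremalWeightEnumerator, eval_weightEnumerator, eval_gleasonPolynomial,
    Finset.sum_eq_zero (s := Finset.univ)] at h1
  · have h2 : ∀ i ∈ Finset.range (n + 1), (weightCount C i : ℤ) * 1 ^ (n - i) * (-1) ^ i =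
        (weightCount C i : ℤ) := by
      intro i _
      rcases Nat.even_or_odd i with hi | hi
      · simp [hi.neg_one_pow]
      · have : weightCount C i = 0 := by
          rw [weightCount, Set.ncard_eq_zero (Set.toFinite _), Set.eq_empty_iff_forall_notMem]
          rintro x ⟨hx, rfl⟩
          exact h x hx hi
        simp [this]
    rw [Finset.sum_congr rfl h2] at h1
    have h3 : ((∑ i ∈ Finset.range (n + 1), weightCount C i : ℕ) : ℤ) = 0 := by
      push_cast
      exact h1
    rw [sum_weightCount, hC.isOptimal.card] at h3
    simp at h3
  · intro i _
    have := i.2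
    obtain ⟨k, rfl⟩ := hn
    rw [add_neg_cancel, zero_pow (by omega)]
    simp

/-! ### Prescribing entries of codewords by duality -/

/-- A proper subspace of `Kⁿ` is orthogonal to a nonzero word. -/
theorem exists_scalarProduct_eq_zero {n : ℕ} {C : Code n} (hC : C ≠ ⊤) :
    ∃ y : Fin n → K, y ≠ 0 ∧ ∀ x ∈ C, scalarProduct x y = 0 := by
  let V : Submodule (ZMod 2) (Fin n → K) := AddSubgroup.toZModSubmodule 2 C
  have hV : V < ⊤ := by
    rw [lt_top_iff_ne_top]
    intro h
    apply hC
    rw [eq_top_iff]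
    intro x _
    have : x ∈ V := h ▸ Submodule.mem_top
    exact this
  obtain ⟨f, hf, hfV⟩ := Submodule.exists_le_ker_of_lt_top V hV
  -- The coordinates are crossed (`b` first, then `a`) because `dot` pairs the first coordinate of
  -- one argument with the second of the other.
  have hf' : ∀ x, f x = scalarProduct x fun i => (f (Pi.single i b), f (Pi.single i a)) := by
    intro x
    have hx : x = ∑ i, ((x i).1 • (Pi.single i a : Fin n → K) + (x i).2 • (Pi.single i b : Fin n → K)) := by
      funext j
      simp [Finset.sum_apply, Pi.single_apply, Finset.sum_add_distrib, a, b]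
    conv_lhs => rw [hx]
    simp only [map_sum, map_add, map_smul, smul_eq_mul, scalarProduct, dot]
  refine ⟨fun i => (f (Pi.single i b), f (Pi.single i a)), ?_, fun x hx => ?_⟩
  · intro h
    apply hf
    refine LinearMap.ext fun x => ?_
    rw [hf', h]
    simp [scalarProduct, dot]
  · rw [← hf']
    exact hfV hx

namespace IsOptimal

variable {n : ℕ} {C : Code n}

theorem eq_zero (hC : IsOptimal C) {x : Fin n → K} (hx : x ∈ C) {S : Finset (Fin n)}
    (hS : S.card ≤ n / 2) (h : ∀ i ∉ S, x i = 0) : x = 0 := by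
  by_contra h0
  have h1 := hC.lt_norm x hx h0
  have h2 : hammingNorm x ≤ S.card := by
    refine Finset.card_le_card fun i hi => ?_
    by_contra h3
    simp [h i h3] at hi
  omega

theorem eq_of_agree (hC : IsOptimal C) {x y : Fin n → K} (hx : x ∈ C) (hy : y ∈ C)
    {S : Finset (Fin n)} (hS : S.card ≤ n / 2) (h : ∀ i ∉ S, x i = y i) : x = y :=
  sub_eq_zero.1 (hC.eq_zero (C.sub_mem hx hy) hS fun i hi => by simp [h i hi])

theorem scalarProduct_eq_zero (hC : IsOptimal C) {x y : Fin n → K} (hx : x ∈ C) (hy : y ∈ C) :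
    scalarProduct x y = 0 := by
  have : x ∈ dual C := hC.selfDual.symm ▸ hx
  exact this y hy

/-- Every assignment on at most `⌊n/2⌋` positions extends to a codeword. -/
theorem exists_agree (hC : IsOptimal C) {S : Finset (Fin n)} (hS : S.card ≤ n / 2)
    (z : Fin n → K) : ∃ x ∈ C, ∀ i ∈ S, x i = z i := by
  classical
  let D : Code n :=
    { carrier := {z | ∃ x ∈ C, ∀ i ∈ S, x i = z i}
      zero_mem' := ⟨0, C.zero_mem, fun _ _ => rfl⟩
      add_mem' := by
        rintro z z' ⟨x, hx, h⟩ ⟨x', hx', h'⟩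
        exact ⟨x + x', C.add_mem hx hx', fun i hi => by simp [h i hi, h' i hi]⟩
      neg_mem' := by
        rintro z ⟨x, hx, h⟩
        exact ⟨-x, C.neg_mem hx, fun i hi => by simp [h i hi]⟩ }
  suffices hD : D = ⊤ by
    have : z ∈ D := hD ▸ AddSubgroup.mem_top z
    exact this
  by_contra hD
  obtain ⟨y, hy0, hy⟩ := exists_scalarProduct_eq_zero hD
  apply hy0
  -- `D` contains `C`, so `y` lies in the dual, which is `C`. `D` also contains every word vanishing
  -- on `S`, so `y` vanishes off `S` and is too light to be nonzero.
  refine hC.eq_zero (S := S) ?_ hS fun i hi => ?_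
  · rw [← hC.selfDual]
    intro x hx
    rw [scalarProduct_comm]
    exact hy x ⟨x, hx, fun _ _ => rfl⟩
  · have h : ∀ t : K, scalarProduct (Pi.single i t) y = dot t (y i) := by
      intro t
      rw [scalarProduct, Finset.sum_eq_single i]
      · simp
      · intro j _ hj
        simp [hj, dot]
      · simp
    have h' : ∀ t : K, dot t (y i) = 0 := by
      intro t
      rw [← h]
      refine hy _ ⟨0, C.zero_mem, fun j hj => ?_⟩
      have : j ≠ i := fun e => hi (e ▸ hj)
      simp [this]
    revert h'
    generalize y i = w
    revert w
    decide


/-- A zero at `i` would confine the support to `T.erase i`, which has at most `n / 2` positions. -/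
theorem apply_ne_zero (hC : IsOptimal C) {x : Fin n → K} (hx : x ∈ C) (h0 : x ≠ 0)
    {T : Finset (Fin n)} (hT : T.card ≤ n / 2 + 1) (h : ∀ i ∉ T, x i = 0) {i : Fin n}
    (hi : i ∈ T) : x i ≠ 0 := by
  intro hxi
  refine h0 (hC.eq_zero hx (S := T.erase i) ?_ fun j hj => ?_)
  · rw [Finset.card_erase_of_mem hi]
    omega
  · by_cases hji : j = i
    · rw [hji, hxi]
    · exact h j fun hjT => hj (Finset.mem_erase.2 ⟨hji, hjT⟩)

/-! ### Even length -/

/-- The length of an optimal code of positive even length is not divisible by four. -/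
theorem odd_half (hC : IsOptimal C) {m : ℕ} (hn : n = 2 * m) (hm : 1 ≤ m) : Odd m := by
  obtain ⟨T, -, hT⟩ := Finset.exists_subset_card_eq
    (s := (Finset.univ : Finset (Fin n))) (n := m + 1) (by simp; omega)
  obtain ⟨i, hi⟩ : T.Nonempty := by
    rw [← Finset.card_pos]
    omega
  have key : ∀ t : K, ∃ x ∈ C, x i = t ∧ ∀ j ∉ T, x j = 0 := by
    intro t
    -- The position `i` together with `Tᶜ` makes `1 + (m - 1) = m` positions, just within the
    -- admissible bound.
    obtain ⟨x, hx, h⟩ := hC.exists_agree (S := insert i Tᶜ) (by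
      rw [Finset.card_insert_of_notMem (by simpa using hi), Finset.card_compl, Fintype.card_fin]
      omega) (Pi.single i t)
    refine ⟨x, hx, by simpa using h i (by simp), fun j hj => ?_⟩
    have : j ≠ i := fun e => hj (e ▸ hi)
    simpa [this] using h j (by simp [hj])
  obtain ⟨x, hx, hxi, hxT⟩ := key a
  obtain ⟨y, hy, hyi, hyT⟩ := key b
  have hT' : T.card ≤ n / 2 + 1 := by omega
  have hx0 : x ≠ 0 := by
    rintro rfl
    exact absurd hxi (by decide : (0 : K) ≠ a)
  have hy0 : y ≠ 0 := by
    rintro rfl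
    exact absurd hyi (by decide : (0 : K) ≠ b)
  have hxy0 : x - y ≠ 0 := by
    intro h
    have := congrFun h i
    rw [Pi.sub_apply, hxi, hyi] at this
    exact absurd this (by decide : a - b ≠ 0)
  have h := hC.scalarProduct_eq_zero hx hy
  -- The words `x`, `y` and `x - y` are nonzero and supported in `m + 1` positions, so none of them
  -- vanishes anywhere on `T`: each position of `T` contributes 1.
  have h1 : scalarProduct x y = ∑ j, if j ∈ T then 1 else 0 := by
    refine Finset.sum_congr rfl fun j _ => ?_
    split_ifs with hj
    · rw [dot_eq, if_pos]
      refine ⟨hC.apply_ne_zero hx hx0 hT' hxT hj, hC.apply_ne_zero hy hy0 hT' hyT hj, fun e => ?_⟩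
      refine hC.apply_ne_zero (C.sub_mem hx hy) hxy0 hT' (fun k hk => ?_) hj ?_
      · simp [hxT k hk, hyT k hk]
      · simp [e]
    · simp [hxT j hj, dot]
  rw [h1] at h
  simp only [Finset.sum_boole, Finset.filter_univ_mem, hT] at h
  rw [ZMod.natCast_eq_zero_iff_even, Nat.even_add_one, Nat.not_even_iff_odd] at h
  exact h

/-- An optimal code of even length has length at most six. -/
theorem half_le_three (hC : IsOptimal C) {m : ℕ} (hn : n = 2 * m) : m ≤ 3 := by
  by_contra! hm
  obtain ⟨T, -, hT⟩ := Finset.exists_subset_card_eq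
    (s := (Finset.univ : Finset (Fin n))) (n := m + 2) (by simp; omega)
  obtain ⟨i, hi⟩ : T.Nonempty := by
    rw [← Finset.card_pos]
    omega
  have hTi : (T.erase i).card = m + 1 := by
    rw [Finset.card_erase_of_mem hi]
    omega
  have key : ∀ j, ∃ x ∈ C, j ∈ T.erase i → x i = a ∧ x j = 0 ∧ ∀ k ∉ T, x k = 0 := by
    intro j
    by_cases hj : j ∈ T.erase i
    swap
    · exact ⟨0, C.zero_mem, fun h => absurd h hj⟩
    obtain ⟨hji, hjT⟩ := Finset.mem_erase.1 hj
    obtain ⟨x, hx, h⟩ := hC.exists_agree (S := insert i (insert j Tᶜ)) (by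
      rw [Finset.card_insert_of_notMem (by simpa using ⟨Ne.symm hji, hi⟩),
        Finset.card_insert_of_notMem (by simpa using hjT), Finset.card_compl, Fintype.card_fin]
      omega) (Pi.single i a)
    refine ⟨x, hx, fun _ => ⟨by simpa using h i (by simp), by simpa [hji] using h j (by simp),
      fun k hk => ?_⟩⟩
    have : k ≠ i := fun e => hk (e ▸ hi)
    simpa [this] using h k (by simp [hk])
  choose w hw hw' using key
  obtain ⟨l, hl⟩ : (T.erase i).Nonempty := by
    rw [← Finset.card_pos]
    omega
  have hlT := (Finset.mem_erase.1 hl).2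
  have hli := (Finset.mem_erase.1 hl).1
  -- If `w j` and `w k` agree at `l`, they agree at `i`, at `l` and off `T`, hence off `m`
  -- positions, so they coincide. For `j ≠ k` the common word vanishes at both `j` and `k`, so it is
  -- zero, against its entry `a` at `i`.
  have hinj : Set.InjOn (fun j => w j l) (T.erase i : Finset (Fin n)) := by
    intro j hj k hk hjk
    rw [Finset.mem_coe] at hj hk
    obtain ⟨hj1, hj2, hj3⟩ := hw' j hj
    obtain ⟨hk1, hk2, hk3⟩ := hw' k hk
    have e : w j = w k := by
      refine hC.eq_of_agree (hw j) (hw k) (S := (T.erase i).erase l) ?_ fun p hp => ?_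
      · rw [Finset.card_erase_of_mem hl]
        omega
      · by_cases hpi : p = i
        · rw [hpi, hj1, hk1]
        by_cases hpl : p = l
        · rw [hpl]
          exact hjk
        have hpT : p ∉ T := fun h => hp (by simp [hpi, hpl, h])
        rw [hj3 p hpT, hk3 p hpT]
    by_contra hne
    obtain ⟨hji, hjT⟩ := Finset.mem_erase.1 hj
    have h0 : w j = 0 := by
      refine hC.eq_zero (hw j) (S := (T.erase j).erase k) ?_ fun p hp => ?_
      · rw [Finset.card_erase_of_mem (Finset.mem_erase.2 ⟨Ne.symm hne, (Finset.mem_erase.1 hk).2⟩),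
          Finset.card_erase_of_mem hjT]
        omega
      · by_cases hpj : p = j
        · rw [hpj, hj2]
        by_cases hpk : p = k
        · rw [hpk, e, hk2]
        exact hj3 p fun h => hp (by simp [hpj, hpk, h])
    rw [h0] at hj1
    exact absurd hj1 (by decide : (0 : K) ≠ a)
  have := Finset.card_le_card_of_injOn (s := T.erase i) (t := (Finset.univ : Finset K))
    (fun j => w j l) (fun _ _ => Finset.mem_univ _) hinj
  rw [hTi, show (Finset.univ : Finset K).card = 4 from rfl] at this
  omega

end IsOptimal

/-! ### Odd length -/

/-- The subcode of the codewords that vanish outside `T`. -/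
def shorten {n : ℕ} (C : Code n) (T : Finset (Fin n)) : Code n where
  carrier := {x | x ∈ C ∧ ∀ i ∉ T, x i = 0}
  zero_mem' := ⟨C.zero_mem, fun _ _ => rfl⟩
  add_mem' := fun hx hy => ⟨C.add_mem hx.1 hy.1, fun i hi => by simp [hx.2 i hi, hy.2 i hi]⟩
  neg_mem' := fun hx => ⟨C.neg_mem hx.1, fun i hi => by simp [hx.2 i hi]⟩

/-- Weight modulo 2 is a quadratic form whose polarisation is the scalar product; hence parity is
additive on a self-dual code. The identity is checked entry by entry. -/
theorem hammingNorm_add_cast {n : ℕ} (x y : Fin n → K) :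
    (hammingNorm (x + y) : ZMod 2) = hammingNorm x + hammingNorm y + scalarProduct x y := by
  have e : ∀ z : Fin n → K, (hammingNorm z : ZMod 2) = ∑ i, if z i ≠ 0 then 1 else 0 := by
    intro z
    rw [hammingNorm, Finset.sum_boole]
  rw [e, e, e, scalarProduct, ← Finset.sum_add_distrib, ← Finset.sum_add_distrib]
  refine Finset.sum_congr rfl fun i _ => ?_
  rw [Pi.add_apply]
  generalize x i = s
  generalize y i = t
  revert s t
  decide

theorem hammingNorm_eq_card {n : ℕ} {x : Fin n → K} {T : Finset (Fin n)} (h : ∀ i ∉ T, x i = 0)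
    (h' : ∀ i ∈ T, x i ≠ 0) : hammingNorm x = T.card := by
  rw [hammingNorm]
  congr 1
  ext i
  by_cases hi : i ∈ T
  · simp [hi, h' i hi]
  · simp [hi, h i hi]

namespace IsOptimal

variable {n : ℕ} {C : Code n}

/-- Restriction of codewords to `Tᶜ` is surjective by `exists_agree`, and its kernel is `shorten C
T`. -/
theorem card_shorten_mul (hC : IsOptimal C) {T : Finset (Fin n)} (hT : Tᶜ.card ≤ n / 2) :
    Nat.card (shorten C T) * 4 ^ Tᶜ.card = 2 ^ n := by
  let r : C →+ ((Tᶜ : Finset (Fin n)) → K) :=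
    { toFun x i := x.1 i
      map_zero' := rfl
      map_add' _ _ := rfl }
  have hr : Function.Surjective r := by
    classical
    intro z
    obtain ⟨x, hx, h⟩ := hC.exists_agree hT fun i => if hi : i ∈ Tᶜ then z ⟨i, hi⟩ else 0
    refine ⟨⟨x, hx⟩, funext fun i => ?_⟩
    exact (h i i.2).trans (dif_pos i.2)
  have hker : Nat.card (shorten C T) = Nat.card r.ker := by
    refine Nat.card_congr ⟨fun x => ⟨⟨x.1, x.2.1⟩, ?_⟩, fun x => ⟨x.1.1, x.1.2, ?_⟩,
      fun _ => rfl, fun _ => rfl⟩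
    · exact funext fun i => x.2.2 i (Finset.mem_compl.1 i.2)
    · intro i hi
      exact congrFun x.2 ⟨i, by simpa using hi⟩
  have h1 := r.ker.card_eq_card_quotient_mul_card_addSubgroup
  rw [Nat.card_congr (QuotientAddGroup.quotientKerEquivOfSurjective r hr).toEquiv, hC.card] at h1
  have h2 : Nat.card ((Tᶜ : Finset (Fin n)) → K) = 4 ^ Tᶜ.card := by
    rw [Nat.card_eq_fintype_card, Fintype.card_fun, Fintype.card_coe]
    rfl
  rw [hker, h1, h2, mul_comm]

/-- Here the subcode has order `2 ^ (2m + 1) / 4 ^ m = 2`. -/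
theorem existsUnique_of_card (hC : IsOptimal C) {m : ℕ} (hn : n = 2 * m + 1)
    {T : Finset (Fin n)} (hT : T.card = m + 1) : ∃! x, x ∈ shorten C T ∧ x ≠ 0 := by
  have hc : Tᶜ.card = m := by
    rw [Finset.card_compl, hT, Fintype.card_fin]
    omega
  have h := hC.card_shorten_mul (T := T) (by omega)
  have e : 2 ^ n = 4 ^ m * 2 := by rw [hn, pow_succ, pow_mul]; norm_num
  rw [hc, e, mul_comm] at h
  have h2 : Nat.card (shorten C T) = 2 := Nat.eq_of_mul_eq_mul_left (by positivity) h
  obtain ⟨x, hx, hu⟩ := (Nat.card_eq_two_iff' (0 : shorten C T)).1 h2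
  refine ⟨x, ⟨x.2, fun h => hx (Subtype.ext h)⟩, fun y hy => ?_⟩
  exact congrArg Subtype.val (hu ⟨y, hy.1⟩ fun h => hy.2 (congrArg Subtype.val h))

theorem exists_of_card (hC : IsOptimal C) {m : ℕ} (hn : n = 2 * m + 1)
    {T : Finset (Fin n)} (hT : T.card = m + 1) :
    ∃ x ∈ C, (∀ i ∉ T, x i = 0) ∧ (∀ i ∈ T, x i ≠ 0) := by
  obtain ⟨x, ⟨hx, h0⟩, -⟩ := hC.existsUnique_of_card hn hT
  exact ⟨x, hx.1, hx.2, fun i hi => hC.apply_ne_zero hx.1 h0 (by omega) hx.2 hi⟩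

/-- If the codewords vanishing outside `T` do not all have even weight, then the length is at most
five. -/
theorem half_le_two_of_odd (hC : IsOptimal C) {m : ℕ} (hn : n = 2 * m + 1) (hm : 1 ≤ m)
    {T : Finset (Fin n)} (hT : T.card = m + 2) {o : Fin n → K} (ho : o ∈ shorten C T)
    (hodd : Odd (hammingNorm o)) : m ≤ 2 := by
  classical
  have hcard : Nat.card (shorten C T) = 8 := by
    have hc : Tᶜ.card = m - 1 := by
      rw [Finset.card_compl, hT, Fintype.card_fin]
      omega
    have h := hC.card_shorten_mul (T := T) (by omega)
    obtain ⟨k, rfl⟩ := Nat.exists_eq_add_of_le' hm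
    have e : 2 ^ n = 4 ^ k * 8 := by
      rw [hn, show 2 * (k + 1) + 1 = 2 * k + 3 by ring, pow_add, pow_mul]
      norm_num
    rw [hc, e, Nat.add_sub_cancel, mul_comm] at h
    exact Nat.eq_of_mul_eq_mul_left (by positivity) h
  let F : Finset (Fin n → K) := Finset.univ.filter fun x => x ∈ shorten C T
  have hF : F.card = 8 := by
    rw [← hcard, Nat.card_eq_fintype_card, Fintype.card_subtype]
  -- Translation by the odd word `o` flips parity, so exactly half of the 8 codewords are odd.
  have hpar : ∀ x ∈ shorten C T, (Odd (hammingNorm (x + o)) ↔ ¬ Odd (hammingNorm x)) := by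
    intro x hx
    have h := hammingNorm_add_cast x o
    rw [hC.scalarProduct_eq_zero hx.1 ho.1, add_zero, ← Nat.cast_add] at h
    have h' := (ZMod.natCast_eq_natCast_iff _ _ _).1 h
    rw [Nat.odd_iff, Nat.odd_iff]
    rw [Nat.odd_iff] at hodd
    unfold Nat.ModEq at h'
    omega
  have hhalf : (F.filter fun x => Odd (hammingNorm x)).card = 4 := by
    have h1 := Finset.card_filter_add_card_filter_not (s := F) fun x => Odd (hammingNorm x)
    have h2 : (F.filter fun x => Odd (hammingNorm x)).card =
        (F.filter fun x => ¬ Odd (hammingNorm x)).card := by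
      have hoo : ∀ x : Fin n → K, x + o + o = x := by
        intro x
        funext i
        rw [Pi.add_apply, Pi.add_apply]
        generalize x i = s
        generalize o i = t
        revert s t
        decide
      refine Finset.card_bij' (fun x _ => x + o) (fun x _ => x + o) ?_ ?_ ?_ ?_
      · intro x hx
        simp only [F, Finset.mem_filter, Finset.mem_univ, true_and] at hx ⊢
        refine ⟨add_mem hx.1 ho, ?_⟩
        rw [hpar x hx.1, not_not]
        exact hx.2
      · intro x hx
        simp only [F, Finset.mem_filter, Finset.mem_univ, true_and] at hx ⊢
        refine ⟨add_mem hx.1 ho, ?_⟩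
        rw [hpar x hx.1]
        exact hx.2
      · intro x _
        exact hoo x
      · intro x _
        exact hoo x
    omega
  -- The words of `Z` have weight `m + 1`; the remaining nonzero words of the subcode have no zero
  -- on `T` and weight `m + 2`. Parity therefore separates the two kinds.
  let Z : Finset (Fin n → K) := F.filter fun x => x ≠ 0 ∧ ∃ i ∈ T, x i = 0
  have hmem : ∀ {x : Fin n → K} {i}, i ∈ T → x i = 0 → x ∈ shorten C T →
      x ∈ shorten C (T.erase i) := by
    intro x i hi hxi hx
    refine ⟨hx.1, fun j hj => ?_⟩
    by_cases hji : j = i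
    · rw [hji, hxi]
    · exact hx.2 j fun h => hj (Finset.mem_erase.2 ⟨hji, h⟩)
  have hTi : ∀ {i}, i ∈ T → (T.erase i).card = m + 1 := by
    intro i hi
    rw [Finset.card_erase_of_mem hi, hT]
    rfl
  have hnz : ∀ {x : Fin n → K} {i}, i ∈ T → x ∈ shorten C (T.erase i) → x ≠ 0 →
      ∀ j ∈ T.erase i, x j ≠ 0 := by
    intro x i hi hx h0 j hj
    exact hC.apply_ne_zero hx.1 h0 (by rw [hTi hi]; omega) hx.2 hj
  -- Each `i ∈ T` corresponds to the unique nonzero codeword supported in `T.erase i`; such a word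
  -- has exactly one zero on `T`, which recovers `i`.
  have hZ : Z.card = m + 2 := by
    rw [← hT]
    symm
    refine Finset.card_bij
      (fun i hi => (hC.existsUnique_of_card hn (hTi hi)).choose) ?_ ?_ ?_
    · intro i hi
      obtain ⟨h1, h2⟩ := (hC.existsUnique_of_card hn (hTi hi)).choose_spec.1
      simp only [Z, F, Finset.mem_filter, Finset.mem_univ, true_and]
      refine ⟨⟨h1.1, fun j hj => h1.2 j fun h => hj (Finset.mem_of_mem_erase h)⟩, h2, i, hi,
        h1.2 i (by simp)⟩
    · intro i hi j hj hij
      obtain ⟨h1, h2⟩ := (hC.existsUnique_of_card hn (hTi hi)).choose_spec.1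
      obtain ⟨h3, -⟩ := (hC.existsUnique_of_card hn (hTi hj)).choose_spec.1
      by_contra hne
      refine hnz hi h1 h2 j (Finset.mem_erase.2 ⟨Ne.symm hne, hj⟩) ?_
      rw [hij]
      exact h3.2 j (by simp)
    · intro x hx
      simp only [Z, F, Finset.mem_filter, Finset.mem_univ, true_and] at hx
      obtain ⟨hxT, h0, i, hi, hxi⟩ := hx
      exact ⟨i, hi, ((hC.existsUnique_of_card hn (hTi hi)).choose_spec.2 x
        ⟨hmem hi hxi hxT, h0⟩).symm⟩
  have hZw : ∀ {x : Fin n → K}, x ∈ shorten C T → x ≠ 0 → ∀ i ∈ T, x i = 0 →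
      hammingNorm x = m + 1 := by
    intro x hx h0 i hi hxi
    rw [hammingNorm_eq_card (hmem hi hxi hx).2 (hnz hi (hmem hi hxi hx) h0), hTi hi]
  have hfull : ∀ {x : Fin n → K}, x ∈ shorten C T → (¬ ∃ i ∈ T, x i = 0) →
      hammingNorm x = m + 2 := by
    intro x hx h
    push Not at h
    rw [hammingNorm_eq_card hx.2 h, hT]
  -- For even `m` the odd words are exactly `Z`, so `m + 2 = 4`. For odd `m` the even words contain
  -- both `Z` and `0`, so `m + 2 ≤ 3`.
  rcases Nat.even_or_odd m with he | he
  · have : F.filter (fun x => Odd (hammingNorm x)) = Z := by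
      refine Finset.filter_congr fun x hx => ?_
      simp only [F, Finset.mem_filter, Finset.mem_univ, true_and] at hx
      constructor
      · intro h
        refine ⟨fun h0 => by simp [h0] at h, ?_⟩
        by_contra h'
        rw [hfull hx h', Nat.odd_iff] at h
        rw [Nat.even_iff] at he
        omega
      · rintro ⟨h0, i, hi, hxi⟩
        rw [hZw hx h0 i hi hxi]
        exact he.add_one
    rw [this, hZ] at hhalf
    omega
  · have : Z ⊆ (F.filter fun x => ¬ Odd (hammingNorm x)).erase 0 := by
      intro x hx
      simp only [Z, F, Finset.mem_filter, Finset.mem_univ, true_and] at hx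
      simp only [F, Finset.mem_filter, Finset.mem_univ, true_and, Finset.mem_erase]
      obtain ⟨h1, h2, i, hi, hxi⟩ := hx
      refine ⟨h2, h1, ?_⟩
      rw [hZw h1 h2 i hi hxi, Nat.not_odd_iff_even]
      exact he.add_one
    have h1 := Finset.card_le_card this
    have h2 := Finset.card_filter_add_card_filter_not (s := F) fun x => Odd (hammingNorm x)
    rw [Finset.card_erase_of_mem (by simp [F, zero_mem])] at h1
    omega

/-- If all codewords supported on `m + 2` positions have even weight, then so do all codewords
supported on more positions. -/
theorem even_of_even (hC : IsOptimal C) {m : ℕ} (hn : n = 2 * m + 1)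
    (h : ∀ T : Finset (Fin n), T.card = m + 2 → ∀ x ∈ shorten C T, Even (hammingNorm x)) (k : ℕ) :
    ∀ T : Finset (Fin n), T.card = m + 2 + k → ∀ x ∈ shorten C T, Even (hammingNorm x) := by
  classical
  induction k with
  | zero => exact h
  | succ k ih =>
    intro T hT x hx
    obtain ⟨i, hi, j, hj, hij⟩ := Finset.one_lt_card.1 (show 1 < T.card by omega)
    have hTn : T.card ≤ n := by simpa using T.card_le_univ
    -- Split `x = (x - y) + y` with `y` vanishing at `i` and `x - y` at `j`, so that the induction
    -- hypothesis applies to both summands. At most `m` entries of `y` are prescribed.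
    obtain ⟨y, hy, hyS⟩ := hC.exists_agree (S := insert i (insert j Tᶜ)) (by
      rw [Finset.card_insert_of_notMem (by simpa using ⟨hij, hi⟩),
        Finset.card_insert_of_notMem (by simpa using hj), Finset.card_compl, Fintype.card_fin]
      omega) (Function.update x i 0)
    have hyi : y i = 0 := by simpa using hyS i (by simp)
    have hyj : y j = x j := by simpa [Ne.symm hij] using hyS j (by simp)
    have hyT : ∀ k ∉ T, y k = 0 := by
      intro k hk
      have hki : k ≠ i := fun e => hk (e ▸ hi)
      rw [hyS k (by simp [hk]), Function.update_of_ne hki, hx.2 k hk]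
    have h1 := ih (T.erase i) (by rw [Finset.card_erase_of_mem hi]; omega) y ⟨hy, fun l hl => by
      by_cases hli : l = i
      · rw [hli, hyi]
      · exact hyT l fun h => hl (Finset.mem_erase.2 ⟨hli, h⟩)⟩
    have h2 := ih (T.erase j) (by rw [Finset.card_erase_of_mem hj]; omega) (x - y)
      ⟨C.sub_mem hx.1 hy, fun l hl => by
      by_cases hlj : l = j
      · simp [hlj, hyj]
      · have hlT : l ∉ T := fun h => hl (Finset.mem_erase.2 ⟨hlj, h⟩)
        simp [hyT l hlT, hx.2 l hlT]⟩
    have h3 := hammingNorm_add_cast (x - y) y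
    rw [sub_add_cancel, hC.scalarProduct_eq_zero (C.sub_mem hx.1 hy) hy,
      (ZMod.natCast_eq_zero_iff_even).2 h1, (ZMod.natCast_eq_zero_iff_even).2 h2] at h3
    exact (ZMod.natCast_eq_zero_iff_even).1 (by simpa using h3)

end IsOptimal

theorem IsExtremal.half_le_two {n : ℕ} {C : Code n} (hC : IsExtremal C) {m : ℕ}
    (hn : n = 2 * m + 1) : m ≤ 2 := by
  by_contra! hm
  obtain ⟨x, hx, hodd⟩ := hC.exists_odd ⟨m, hn⟩
  rw [← Nat.not_even_iff_odd] at hodd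
  apply hodd
  -- The value `m - 1` of `k` makes `m + 2 + k = n`, so the set of all positions is reached.
  refine hC.isOptimal.even_of_even hn (fun T hT y hy => ?_) (m - 1) Finset.univ
    (by simp; omega) x ⟨hx, fun i hi => absurd (Finset.mem_univ i) hi⟩
  by_contra h
  rw [Nat.not_even_iff_odd] at h
  have := hC.isOptimal.half_le_two_of_odd hn (by omega) hT hy h
  omega

/-- The lengths of the extremal codes. -/
theorem IsExtremal.length_mem {n : ℕ} {C : Code n} (hC : IsExtremal C) (hn : 1 ≤ n) :
    n = 1 ∨ n = 2 ∨ n = 3 ∨ n = 5 ∨ n = 6 := by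
  obtain ⟨m, h | h⟩ := Nat.even_or_odd' n
  · have h1 := hC.isOptimal.half_le_three h
    have h2 := hC.isOptimal.odd_half h (by omega)
    rw [Nat.odd_iff] at h2
    omega
  · have := hC.half_le_two h
    omega

/-! ### Relabelling positions and symbols -/

/-- A permutation of `K` that fixes `0` is an automorphism. -/
def autOfPerm (p : Equiv.Perm K) (h : p 0 = 0) : K ≃+ K :=
  AddEquiv.mk' p <| by
    have : ∀ p : Equiv.Perm K, p 0 = 0 → ∀ x y, p (x + y) = p x + p y := by decide +kernel
    exact this p h

set_option synthInstance.maxSize 1000 in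
theorem exists_aut_eq_a_b {x y : K} (hx : x ≠ 0) (hy : y ≠ 0) (hxy : x ≠ y) :
    ∃ σ : K ≃+ K, σ x = a ∧ σ y = b := by
  have : ∀ x y : K, x ≠ 0 → y ≠ 0 → x ≠ y → ∃ p : Equiv.Perm K, p 0 = 0 ∧ p x = a ∧ p y = b := by
    decide +kernel
  obtain ⟨p, h0, h⟩ := this x y hx hy hxy
  exact ⟨autOfPerm p h0, h⟩

/-- The automorphisms permute the three nonzero symbols arbitrarily. This is what allows two entries
to be normalised at each position. -/
theorem exists_aut {x y z w : K} (hx : x ≠ 0) (hy : y ≠ 0) (hxy : x ≠ y) (hz : z ≠ 0)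
    (hw : w ≠ 0) (hzw : z ≠ w) : ∃ σ : K ≃+ K, σ x = z ∧ σ y = w := by
  obtain ⟨σ, h1, h2⟩ := exists_aut_eq_a_b hx hy hxy
  obtain ⟨τ, h3, h4⟩ := exists_aut_eq_a_b hz hw hzw
  refine ⟨σ.trans τ.symm, ?_, ?_⟩
  · rw [AddEquiv.trans_apply, h1, ← h3, AddEquiv.symm_apply_apply]
  · rw [AddEquiv.trans_apply, h2, ← h4, AddEquiv.symm_apply_apply]

theorem dot_aut (σ : K ≃+ K) (x y : K) : dot (σ x) (σ y) = dot x y := by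
  simp [dot_eq]

/-- The permutation of the positions and the symbols of words given by `e` and `σ`. -/
def relabel {n : ℕ} (e : Fin n ≃ Fin n) (σ : Fin n → (K ≃+ K)) :
    (Fin n → K) ≃+ (Fin n → K) where
  toFun x j := σ j (x (e j))
  invFun y i := (σ (e.symm i)).symm (y (e.symm i))
  left_inv x := by
    funext i
    simp only [AddEquiv.symm_apply_apply]
    rw [e.apply_symm_apply]
  right_inv y := by
    funext j
    dsimp only
    rw [e.symm_apply_apply, AddEquiv.apply_symm_apply]
  map_add' x y := by
    funext j
    simp

theorem relabel_apply {n : ℕ} (e : Fin n ≃ Fin n) (σ : Fin n → (K ≃+ K)) (x : Fin n → K)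
    (j : Fin n) : relabel e σ x j = σ j (x (e j)) := rfl

theorem scalarProduct_relabel {n : ℕ} (e : Fin n ≃ Fin n) (σ : Fin n → (K ≃+ K))
    (x y : Fin n → K) : scalarProduct (relabel e σ x) (relabel e σ y) = scalarProduct x y := by
  simp only [scalarProduct, relabel_apply, dot_aut]
  exact Equiv.sum_comp e fun i => dot (x i) (y i)

theorem hammingNorm_relabel {n : ℕ} (e : Fin n ≃ Fin n) (σ : Fin n → (K ≃+ K))
    (x : Fin n → K) : hammingNorm (relabel e σ x) = hammingNorm x := by
  refine Finset.card_bij (fun j _ => e j) ?_ ?_ ?_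
  · intro j hj
    simpa [relabel_apply] using hj
  · intro i _ j _ h
    exact e.injective h
  · intro i hi
    exact ⟨e.symm i, by simpa [relabel_apply] using hi, e.apply_symm_apply i⟩

theorem equivalent_map_relabel {n : ℕ} (C : Code n) (e : Fin n ≃ Fin n)
    (σ : Fin n → (K ≃+ K)) : Equivalent C (C.map (relabel e σ).toAddMonoidHom) := by
  refine ⟨e, σ, fun x => ⟨fun hx => ⟨x, hx, rfl⟩, ?_⟩⟩
  rintro ⟨y, hy, h⟩
  exact (relabel e σ).injective h ▸ hy

theorem Equivalent.trans {l m n : ℕ} {C : Code l} {D : Code m} {E : Code n}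
    (h : Equivalent C D) (h' : Equivalent D E) : Equivalent C E := by
  obtain ⟨e, σ, h⟩ := h
  obtain ⟨e', σ', h'⟩ := h'
  exact ⟨e'.trans e, fun j => (σ (e' j)).trans (σ' j), fun x => (h x).trans (h' _)⟩

theorem Equivalent.length_eq {m n : ℕ} {C : Code m} {D : Code n} (h : Equivalent C D) :
    m = n := by
  obtain ⟨e, -⟩ := h
  simpa using (Fintype.card_congr e).symm

namespace IsOptimal

variable {n : ℕ} {C : Code n}

theorem map_relabel (hC : IsOptimal C) (e : Fin n ≃ Fin n) (σ : Fin n → (K ≃+ K)) :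
    IsOptimal (C.map (relabel e σ).toAddMonoidHom) := by
  refine ⟨?_, ?_, ?_⟩
  · apply le_antisymm
    · intro x hx
      refine ⟨(relabel e σ).symm x, ?_, (relabel e σ).apply_symm_apply x⟩
      rw [SetLike.mem_coe, ← hC.selfDual]
      intro y hy
      rw [← scalarProduct_relabel e σ, AddEquiv.apply_symm_apply]
      exact hx _ ⟨y, hy, rfl⟩
    · rintro _ ⟨x, hx, rfl⟩ _ ⟨y, hy, rfl⟩
      exact (scalarProduct_relabel e σ x y).trans (hC.scalarProduct_eq_zero hx hy)
  · rintro _ ⟨x, hx, rfl⟩ h0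
    change n / 2 < hammingNorm (relabel e σ x)
    rw [hammingNorm_relabel]
    exact hC.lt_norm x hx fun h => h0 (by rw [h, map_zero])
  · rw [← hC.card]
    exact (Nat.card_congr (C.equivMapOfInjective _ (relabel e σ).injective).toEquiv).symm

/-- Both codes have order `2 ^ n`, so finding the basis words in the relabelled code is enough. -/
theorem equivalent_range_encode (hC : IsOptimal C) {g : Fin n → Fin n → K}
    (hg : Function.Injective (encode g)) (e : Fin n ≃ Fin n) (σ : Fin n → (K ≃+ K))
    (h : ∀ i, ∃ x ∈ C, relabel e σ x = g i) : Equivalent C (encode g).range := by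
  have : (encode g).range = C.map (relabel e σ).toAddMonoidHom := by
    refine AddSubgroup.eq_of_le_of_card_ge (range_encode_le h) ?_
    rw [card_range_encode hg, (hC.map_relabel e σ).card]
  rw [this]
  exact equivalent_map_relabel C e σ

theorem apply_ne (hC : IsOptimal C) {x y : Fin n → K} (hx : x ∈ C) (hy : y ∈ C) (hxy : x ≠ y)
    {T : Finset (Fin n)} (hT : T.card ≤ n / 2 + 1) (h : ∀ i, i ∈ T ∨ x i = y i) {i : Fin n}
    (hi : i ∈ T) : x i ≠ y i := by
  have := hC.apply_ne_zero (C.sub_mem hx hy) (sub_ne_zero.2 hxy) hT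
    (fun j hj => sub_eq_zero.2 ((h j).resolve_left hj)) hi
  exact sub_ne_zero.1 this

/-- If the supports of two codewords have two positions in common, and each has at most one
further position, then the codewords differ at the common positions. -/
theorem apply_ne_of_inter (hC : IsOptimal C) (hn : 2 ≤ n / 2) {x y : Fin n → K} (hx : x ∈ C)
    (hy : y ∈ C) {i j k l : Fin n} (hij : i ≠ j) (hxy : x k ≠ y k)
    (hxj : x j ≠ 0) (hyj : y j ≠ 0) (h : ∀ p, p = i ∨ p = j ∨ (p = k ∧ y p = 0) ∨
      (p = l ∧ x p = 0) ∨ (x p = 0 ∧ y p = 0)) : x i ≠ y i := by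
  -- Equality at `i` makes the contribution of `i` to the scalar product vanish, so that of `j`
  -- vanishes too and `x j = y j`. Then `x - y` is supported in `{k, l}`, hence zero, although `x`
  -- and `y` differ at `k`.
  intro hi
  have h0 := hC.scalarProduct_eq_zero hx hy
  rw [scalarProduct, Finset.sum_eq_add_of_mem i j (Finset.mem_univ _) (Finset.mem_univ _) hij,
    hi] at h0
  · have hj : x j = y j := by
      generalize x j = s at *
      generalize y j = t at *
      generalize y i = r at *
      have : ∀ r s t : K, s ≠ 0 → t ≠ 0 → dot r r + dot s t = 0 → s = t := by decide
      exact this r s t hxj hyj h0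
    refine hxy (congrFun (hC.eq_of_agree hx hy (S := {k, l}) (Finset.card_le_two.trans hn)
      fun p hp => ?_) k)
    simp only [Finset.mem_insert, Finset.mem_singleton, not_or] at hp
    rcases h p with rfl | rfl | ⟨h1, -⟩ | ⟨h1, -⟩ | ⟨h1, h2⟩
    · exact hi
    · exact hj
    · exact absurd h1 hp.1
    · exact absurd h1 hp.2
    · rw [h1, h2]
  · intro p _ hp
    rcases h p with h1 | h1 | ⟨-, h1⟩ | ⟨-, h1⟩ | ⟨h1, -⟩
    · exact absurd h1 hp.1
    · exact absurd h1 hp.2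
    all_goals simp [h1, dot]

/-! ### Uniqueness in lengths 1, 2, 3, 5 and 6 -/

theorem exists_apply_eq (hC : IsOptimal C) (hn : 1 ≤ n / 2) (i : Fin n) (t : K) :
    ∃ x ∈ C, x i = t := by
  obtain ⟨x, hx, h⟩ := hC.exists_agree (S := {i}) (by simpa using hn) fun _ => t
  exact ⟨x, hx, h i (by simp)⟩

theorem equivalent_gamma1 {C : Code 1} (hC : IsOptimal C) : Equivalent C gamma1 := by
  obtain ⟨x, hx, -, h0⟩ := hC.exists_of_card (m := 0) rfl (T := {0}) rfl
  -- Only the image of `x 0` matters; `t` is an auxiliary second symbol needed to apply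
  -- `exists_aut`.
  obtain ⟨t, ht0, htx⟩ := (by decide : ∀ s : K, ∃ t, t ≠ 0 ∧ s ≠ t) (x 0)
  obtain ⟨σ, hσ, -⟩ := exists_aut (z := a) (w := b) (h0 0 (by simp)) ht0 htx
    (by decide) (by decide) (by decide)
  rw [gamma1_eq_range]
  refine hC.equivalent_range_encode ?_ (Equiv.refl _) (fun _ => σ) fun i => ⟨x, hx, ?_⟩
  · rw [injective_iff_map_eq_zero]
    decide +kernel
  · funext j
    fin_cases i
    fin_cases j
    exact hσ

/-- With minimum weight 2, codewords that differ at position 0 also differ at position 1, so one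
automorphism at position 1 brings the two chosen words to `(aa)` and `(bb)`. -/
theorem equivalent_epsilon2 {C : Code 2} (hC : IsOptimal C) : Equivalent C epsilon2 := by
  obtain ⟨x, hx, hx0⟩ := hC.exists_apply_eq (by decide) 0 a
  obtain ⟨y, hy, hy0⟩ := hC.exists_apply_eq (by decide) 0 b
  have hne : ∀ {x y : Fin 2 → K}, x ∈ C → y ∈ C → x 0 ≠ y 0 → x 1 ≠ y 1 := by
    intro x y hx hy h
    exact hC.apply_ne hx hy (fun e => h (by rw [e])) (T := Finset.univ) (by simp) (by simp)
      (Finset.mem_univ 1)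
  obtain ⟨σ, hσa, hσb⟩ := exists_aut (z := a) (w := b)
    (hne hx C.zero_mem (by rw [hx0]; decide)) (hne hy C.zero_mem (by rw [hy0]; decide))
    (hne hx hy (by rw [hx0, hy0]; decide)) (by decide) (by decide) (by decide)
  rw [epsilon2_eq_range]
  refine hC.equivalent_range_encode ?_ (Equiv.refl _) ![AddEquiv.refl K, σ] ?_
  · rw [injective_iff_map_eq_zero]
    decide +kernel
  · rw [Fin.forall_fin_two]
    refine ⟨⟨x, hx, ?_⟩, y, hy, ?_⟩
    · funext j
      fin_cases j
      exacts [hx0, hσa]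
    · funext j
      fin_cases j
      exacts [hy0, hσb]

/-- The supports of `x` and `y` meet only at 0, so orthogonality gives `x 0 = y 0`. A codeword `z`
with another nonzero symbol at 0 must, by orthogonality to `x` and `y`, have a nonzero symbol
different from theirs at 1 and 2 as well. -/
theorem equivalent_delta3Plus {C : Code 3} (hC : IsOptimal C) : Equivalent C delta3Plus := by
  obtain ⟨x, hx, hx', hx0⟩ := hC.exists_of_card (m := 1) rfl (T := {0, 1}) rfl
  obtain ⟨y, hy, hy', hy0⟩ := hC.exists_of_card (m := 1) rfl (T := {0, 2}) rfl
  obtain ⟨t, ht0, htx⟩ := (by decide : ∀ s : K, ∃ t, t ≠ 0 ∧ s ≠ t) (x 0)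
  obtain ⟨z, hz, hz0⟩ := hC.exists_apply_eq (by decide) 0 t
  have h1 := hC.scalarProduct_eq_zero hx hy
  have h2 := hC.scalarProduct_eq_zero hx hz
  have h3 := hC.scalarProduct_eq_zero hy hz
  have hx2 : x 2 = 0 := hx' 2 (by decide)
  have hy1 : y 1 = 0 := hy' 1 (by decide)
  have hxa := hx0 0 (by decide)
  have hxb := hx0 1 (by decide)
  have hya := hy0 0 (by decide)
  have hyb := hy0 2 (by decide)
  rw [scalarProduct, Fin.sum_univ_three] at h1 h2 h3
  rw [hx2, hy1] at h1
  rw [hx2, hz0] at h2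
  rw [hy1, hz0] at h3
  have hxy : x 0 = y 0 := by
    revert h1 hxa hya
    generalize x 0 = p
    generalize y 0 = q
    generalize x 1 = r
    generalize y 2 = s
    revert p q r s
    decide
  have key : ∀ p q r s : K, (p ≠ 0 ∧ q ≠ 0 ∧ p ≠ q) ∧ dot p q + dot r s = 0 → s ≠ 0 ∧ r ≠ s := by
    decide
  obtain ⟨hz1, hxz⟩ := key _ _ _ _ ⟨⟨hxa, ht0, htx⟩, by simpa [dot] using h2⟩
  obtain ⟨hz2, hyz⟩ := key _ _ _ _ ⟨⟨hya, ht0, hxy ▸ htx⟩, by simpa [dot] using h3⟩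
  obtain ⟨σ, hσ1, hσ2⟩ := exists_aut (z := a) (w := b) hxa ht0 htx
    (by decide) (by decide) (by decide)
  obtain ⟨τ, hτ1, hτ2⟩ := exists_aut (z := a) (w := b) hxb hz1 hxz
    (by decide) (by decide) (by decide)
  obtain ⟨ρ, hρ1, hρ2⟩ := exists_aut (z := a) (w := b) hyb hz2 hyz
    (by decide) (by decide) (by decide)
  rw [delta3Plus_eq_range]
  refine hC.equivalent_range_encode ?_ (Equiv.refl _) ![σ, τ, ρ] ?_
  · rw [injective_iff_map_eq_zero]
    decide +kernel
  · have h : relabel (Equiv.refl _) ![σ, τ, ρ] x = ![a, a, 0] ∧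
        relabel (Equiv.refl _) ![σ, τ, ρ] y = ![a, 0, a] ∧
        relabel (Equiv.refl _) ![σ, τ, ρ] z = ![b, b, b] := by
      refine ⟨?_, ?_, ?_⟩ <;> funext j <;> fin_cases j
      exacts [hσ1, hτ1, (congrArg ρ hx2).trans (map_zero ρ), (congrArg σ hxy.symm).trans hσ1,
        (congrArg τ hy1).trans (map_zero τ), hρ1, (congrArg σ hz0).trans hσ2, hτ2, hρ2]
    intro i
    fin_cases i
    exacts [⟨x, hx, h.1⟩, ⟨y, hy, h.2.1⟩, ⟨z, hz, h.2.2⟩]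

/-- The five chosen words have supports of size 3. By `apply_ne_of_inter`, suitable pairs differ
where their supports meet, which provides two distinct symbols to normalise at each position;
orthogonality determines the five entries left over. -/
theorem equivalent_shorterHexacode {C : Code 5} (hC : IsOptimal C) :
    Equivalent C shorterHexacode := by
  obtain ⟨w, hw, hw', hw0⟩ := hC.exists_of_card (m := 2) rfl (T := {2, 3, 4}) rfl
  obtain ⟨x, hx, hx', hx0⟩ := hC.exists_of_card (m := 2) rfl (T := {0, 3, 4}) rfl
  obtain ⟨y, hy, hy', hy0⟩ := hC.exists_of_card (m := 2) rfl (T := {0, 2, 4}) rfl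
  obtain ⟨u, hu, hu', hu0⟩ := hC.exists_of_card (m := 2) rfl (T := {1, 3, 4}) rfl
  obtain ⟨v, hv, hv', hv0⟩ := hC.exists_of_card (m := 2) rfl (T := {1, 2, 4}) rfl
  have w0z := hw' 0 (by decide)
  have w1z := hw' 1 (by decide)
  have w2 := hw0 2 (by decide)
  have w3 := hw0 3 (by decide)
  have w4 := hw0 4 (by decide)
  have x0 := hx0 0 (by decide)
  have x1z := hx' 1 (by decide)
  have x2z := hx' 2 (by decide)
  have x3 := hx0 3 (by decide)
  have x4 := hx0 4 (by decide)
  have y0 := hy0 0 (by decide)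
  have y1z := hy' 1 (by decide)
  have y2 := hy0 2 (by decide)
  have y3z := hy' 3 (by decide)
  have y4 := hy0 4 (by decide)
  have u0z := hu' 0 (by decide)
  have u1 := hu0 1 (by decide)
  have u2z := hu' 2 (by decide)
  have u3 := hu0 3 (by decide)
  have u4 := hu0 4 (by decide)
  have v0z := hv' 0 (by decide)
  have v1 := hv0 1 (by decide)
  have v2 := hv0 2 (by decide)
  have v3z := hv' 3 (by decide)
  have v4 := hv0 4 (by decide)
  have xw3 : x 3 ≠ w 3 := by
    refine hC.apply_ne_of_inter (by decide) hx hw (i := 3) (j := 4) (k := 0) (l := 2)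
      (by decide) (by rwa [w0z]) x4 w4 ?_
    intro p
    fin_cases p <;> simp [*]
  have xw4 : x 4 ≠ w 4 := by
    refine hC.apply_ne_of_inter (by decide) hx hw (i := 4) (j := 3) (k := 0) (l := 2)
      (by decide) (by rwa [w0z]) x3 w3 ?_
    intro p
    fin_cases p <;> simp [*]
  have yw2 : y 2 ≠ w 2 := by
    refine hC.apply_ne_of_inter (by decide) hy hw (i := 2) (j := 4) (k := 0) (l := 3)
      (by decide) (by rwa [w0z]) y4 w4 ?_
    intro p
    fin_cases p <;> simp [*]
  have xy0 : x 0 ≠ y 0 := by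
    refine hC.apply_ne_of_inter (by decide) hx hy (i := 0) (j := 4) (k := 3) (l := 2)
      (by decide) (by rwa [y3z]) x4 y4 ?_
    intro p
    fin_cases p <;> simp [*]
  have uv1 : u 1 ≠ v 1 := by
    refine hC.apply_ne_of_inter (by decide) hu hv (i := 1) (j := 4) (k := 3) (l := 2)
      (by decide) (by rwa [v3z]) u4 v4 ?_
    intro p
    fin_cases p <;> simp [*]
  obtain ⟨σ0, hσ0, hσ0'⟩ := exists_aut (z := c) (w := b) x0 y0 xy0
    (by decide) (by decide) (by decide)
  obtain ⟨σ1, hσ1, hσ1'⟩ := exists_aut (z := c) (w := b) u1 v1 uv1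
    (by decide) (by decide) (by decide)
  obtain ⟨σ2, hσ2, hσ2'⟩ := exists_aut (z := a) (w := b) w2 y2 yw2.symm
    (by decide) (by decide) (by decide)
  obtain ⟨σ3, hσ3, hσ3'⟩ := exists_aut (z := a) (w := b) w3 x3 xw3.symm
    (by decide) (by decide) (by decide)
  obtain ⟨σ4, hσ4, hσ4'⟩ := exists_aut (z := a) (w := b) w4 x4 xw4.symm
    (by decide) (by decide) (by decide)
  let σ : Fin 5 → (K ≃+ K) := ![σ0, σ1, σ2, σ3, σ4]
  have hS : ∀ {f g : Fin 5 → K}, f ∈ C → g ∈ C →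
      scalarProduct (relabel (Equiv.refl _) σ f) (relabel (Equiv.refl _) σ g) = 0 := by
    intro f g hf hg
    rw [scalarProduct_relabel, hC.scalarProduct_eq_zero hf hg]
  have Rw : relabel (Equiv.refl _) σ w = ![0, 0, a, a, a] := by
    funext j
    fin_cases j <;> simp [σ, relabel_apply, *]
  have Rx : relabel (Equiv.refl _) σ x = ![c, 0, 0, b, b] := by
    funext j
    fin_cases j <;> simp [σ, relabel_apply, *]
  have Ry : relabel (Equiv.refl _) σ y = ![b, 0, b, 0, σ4 (y 4)] := by
    funext j
    fin_cases j <;> simp [σ, relabel_apply, *]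
  have Ru : relabel (Equiv.refl _) σ u = ![0, c, 0, σ3 (u 3), σ4 (u 4)] := by
    funext j
    fin_cases j <;> simp [σ, relabel_apply, *]
  have Rv : relabel (Equiv.refl _) σ v = ![0, b, σ2 (v 2), 0, σ4 (v 4)] := by
    funext j
    fin_cases j <;> simp [σ, relabel_apply, *]
  have hy4 : σ4 (y 4) = c := by
    have h1 := hS hy hw
    have h2 := hS hy hx
    rw [Ry] at h1 h2
    rw [Rw] at h1
    rw [Rx] at h2
    have h3 : σ4 (y 4) ≠ 0 := by simpa using y4
    revert h1 h2 h3
    generalize σ4 (y 4) = s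
    revert s
    decide +kernel
  rw [hy4] at Ry
  have hu34 : σ3 (u 3) = c ∧ σ4 (u 4) = c := by
    have h1 := hS hu hw
    have h2 := hS hu hx
    have h3 := hS hu hy
    rw [Ru] at h1 h2 h3
    rw [Rw] at h1
    rw [Rx] at h2
    rw [Ry] at h3
    have h4 : σ3 (u 3) ≠ 0 := by simpa using u3
    have h5 : σ4 (u 4) ≠ 0 := by simpa using u4
    have h := And.intro (And.intro h1 (And.intro h2 h3)) (And.intro h4 h5)
    clear h1 h2 h3 h4 h5
    revert h
    generalize σ3 (u 3) = s
    generalize σ4 (u 4) = t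
    revert s t
    decide +kernel
  have hv24 : σ2 (v 2) = c ∧ σ4 (v 4) = b := by
    have h1 := hS hv hw
    have h2 := hS hv hx
    have h3 := hS hv hy
    rw [Rv] at h1 h2 h3
    rw [Rw] at h1
    rw [Rx] at h2
    rw [Ry] at h3
    have h4 : σ2 (v 2) ≠ 0 := by simpa using v2
    have h5 : σ4 (v 4) ≠ 0 := by simpa using v4
    have h := And.intro (And.intro h1 (And.intro h2 h3)) (And.intro h4 h5)
    clear h1 h2 h3 h4 h5
    revert h
    generalize σ2 (v 2) = s
    generalize σ4 (v 4) = t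
    revert s t
    decide +kernel
  rw [hu34.1, hu34.2] at Ru
  rw [hv24.1, hv24.2] at Rv
  rw [shorterHexacode_eq_range]
  refine hC.equivalent_range_encode encode_shorterHexacodeBasis_injective (Equiv.refl _) σ ?_
  intro i
  fin_cases i
  exacts [⟨w, hw, Rw⟩, ⟨x, hx, Rx⟩, ⟨y, hy, Ry⟩, ⟨u, hu, Ru⟩, ⟨v, hv, Rv⟩]

-- The pairs `x, y`, `z, w` and `u, v` are supported in `{0, 3, 4, 5}`, `{1, 3, 4, 5}` and `{2, 3,
-- 4, 5}`. Minimum weight 4 makes each word nonzero on its set and the two words of a pair distinct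
-- throughout it. All pairs share the same two symbols at position 3, so one automorphism there
-- normalises them together.
set_option synthInstance.maxSize 1000 in
theorem equivalent_hexacode {C : Code 6} (hC : IsOptimal C) : Equivalent C hexacode := by
  obtain ⟨x, hx, hx'⟩ := hC.exists_agree (S := {0, 1, 2}) (by decide)
    ![a, 0, 0, 0, 0, 0]
  have x0e : x 0 = a := hx' 0 (by decide)
  have x1z : x 1 = 0 := hx' 1 (by decide)
  have x2z : x 2 = 0 := hx' 2 (by decide)
  obtain ⟨y, hy, hy'⟩ := hC.exists_agree (S := {0, 1, 2}) (by decide)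
    ![b, 0, 0, 0, 0, 0]
  have y0e : y 0 = b := hy' 0 (by decide)
  have y1z : y 1 = 0 := hy' 1 (by decide)
  have y2z : y 2 = 0 := hy' 2 (by decide)
  obtain ⟨z, hz, hz'⟩ := hC.exists_agree (S := {0, 2, 3}) (by decide)
    ![0, 0, 0, x 3, 0, 0]
  have z0z : z 0 = 0 := hz' 0 (by decide)
  have z2z : z 2 = 0 := hz' 2 (by decide)
  have z3e : z 3 = x 3 := hz' 3 (by decide)
  obtain ⟨w, hw, hw'⟩ := hC.exists_agree (S := {0, 2, 3}) (by decide)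
    ![0, 0, 0, y 3, 0, 0]
  have w0z : w 0 = 0 := hw' 0 (by decide)
  have w2z : w 2 = 0 := hw' 2 (by decide)
  have w3e : w 3 = y 3 := hw' 3 (by decide)
  obtain ⟨u, hu, hu'⟩ := hC.exists_agree (S := {0, 1, 3}) (by decide)
    ![0, 0, 0, x 3, 0, 0]
  have u0z : u 0 = 0 := hu' 0 (by decide)
  have u1z : u 1 = 0 := hu' 1 (by decide)
  have u3e : u 3 = x 3 := hu' 3 (by decide)
  obtain ⟨v, hv, hv'⟩ := hC.exists_agree (S := {0, 1, 3}) (by decide)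
    ![0, 0, 0, y 3, 0, 0]
  have v0z : v 0 = 0 := hv' 0 (by decide)
  have v1z : v 1 = 0 := hv' 1 (by decide)
  have v3e : v 3 = y 3 := hv' 3 (by decide)
  have xN : ∀ i ∈ ({0, 3, 4, 5} : Finset (Fin 6)), x i ≠ 0 := by
    intro i hi
    refine hC.apply_ne hx C.zero_mem (fun h => ?_) (by decide) (fun j => ?_) hi
    · exact absurd (x0e.symm.trans (congrFun h 0)) (by decide : a ≠ 0)
    · fin_cases j
      exacts [Or.inl (by decide), Or.inr x1z, Or.inr x2z, Or.inl (by decide), Or.inl (by decide), Or.inl (by decide)]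
  have x3 := xN 3 (by decide)
  have x4 := xN 4 (by decide)
  have x5 := xN 5 (by decide)
  have yN : ∀ i ∈ ({0, 3, 4, 5} : Finset (Fin 6)), y i ≠ 0 := by
    intro i hi
    refine hC.apply_ne hy C.zero_mem (fun h => ?_) (by decide) (fun j => ?_) hi
    · exact absurd (y0e.symm.trans (congrFun h 0)) (by decide : b ≠ 0)
    · fin_cases j
      exacts [Or.inl (by decide), Or.inr y1z, Or.inr y2z, Or.inl (by decide), Or.inl (by decide), Or.inl (by decide)]
  have y3 := yN 3 (by decide)
  have y4 := yN 4 (by decide)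
  have y5 := yN 5 (by decide)
  have xyN : ∀ i ∈ ({0, 3, 4, 5} : Finset (Fin 6)), x i ≠ y i := by
    intro i hi
    refine hC.apply_ne hx hy (fun h => ?_) (by decide) (fun j => ?_) hi
    · exact absurd (x0e.symm.trans ((congrFun h 0).trans y0e)) (by decide : a ≠ b)
    · fin_cases j
      exacts [Or.inl (by decide), Or.inr (x1z.trans y1z.symm), Or.inr (x2z.trans y2z.symm), Or.inl (by decide), Or.inl (by decide), Or.inl (by decide)]
  have xy3 := xyN 3 (by decide)
  have xy4 := xyN 4 (by decide)
  have xy5 := xyN 5 (by decide)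
  have zN : ∀ i ∈ ({1, 3, 4, 5} : Finset (Fin 6)), z i ≠ 0 := by
    intro i hi
    refine hC.apply_ne hz C.zero_mem (fun h => ?_) (by decide) (fun j => ?_) hi
    · exact x3 (z3e.symm.trans (congrFun h 3))
    · fin_cases j
      exacts [Or.inr z0z, Or.inl (by decide), Or.inr z2z, Or.inl (by decide), Or.inl (by decide), Or.inl (by decide)]
  have z1 := zN 1 (by decide)
  have z4 := zN 4 (by decide)
  have z5 := zN 5 (by decide)
  have wN : ∀ i ∈ ({1, 3, 4, 5} : Finset (Fin 6)), w i ≠ 0 := by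
    intro i hi
    refine hC.apply_ne hw C.zero_mem (fun h => ?_) (by decide) (fun j => ?_) hi
    · exact y3 (w3e.symm.trans (congrFun h 3))
    · fin_cases j
      exacts [Or.inr w0z, Or.inl (by decide), Or.inr w2z, Or.inl (by decide), Or.inl (by decide), Or.inl (by decide)]
  have w1 := wN 1 (by decide)
  have w4 := wN 4 (by decide)
  have w5 := wN 5 (by decide)
  have zwN : ∀ i ∈ ({1, 3, 4, 5} : Finset (Fin 6)), z i ≠ w i := by
    intro i hi
    refine hC.apply_ne hz hw (fun h => ?_) (by decide) (fun j => ?_) hi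
    · exact xy3 (z3e.symm.trans ((congrFun h 3).trans w3e))
    · fin_cases j
      exacts [Or.inr (z0z.trans w0z.symm), Or.inl (by decide), Or.inr (z2z.trans w2z.symm), Or.inl (by decide), Or.inl (by decide), Or.inl (by decide)]
  have zw1 := zwN 1 (by decide)
  have zw4 := zwN 4 (by decide)
  have zw5 := zwN 5 (by decide)
  have uN : ∀ i ∈ ({2, 3, 4, 5} : Finset (Fin 6)), u i ≠ 0 := by
    intro i hi
    refine hC.apply_ne hu C.zero_mem (fun h => ?_) (by decide) (fun j => ?_) hi
    · exact x3 (u3e.symm.trans (congrFun h 3))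
    · fin_cases j
      exacts [Or.inr u0z, Or.inr u1z, Or.inl (by decide), Or.inl (by decide), Or.inl (by decide), Or.inl (by decide)]
  have u2 := uN 2 (by decide)
  have u4 := uN 4 (by decide)
  have u5 := uN 5 (by decide)
  have vN : ∀ i ∈ ({2, 3, 4, 5} : Finset (Fin 6)), v i ≠ 0 := by
    intro i hi
    refine hC.apply_ne hv C.zero_mem (fun h => ?_) (by decide) (fun j => ?_) hi
    · exact y3 (v3e.symm.trans (congrFun h 3))
    · fin_cases j
      exacts [Or.inr v0z, Or.inr v1z, Or.inl (by decide), Or.inl (by decide), Or.inl (by decide), Or.inl (by decide)]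
  have v2 := vN 2 (by decide)
  have v4 := vN 4 (by decide)
  have v5 := vN 5 (by decide)
  have uvN : ∀ i ∈ ({2, 3, 4, 5} : Finset (Fin 6)), u i ≠ v i := by
    intro i hi
    refine hC.apply_ne hu hv (fun h => ?_) (by decide) (fun j => ?_) hi
    · exact xy3 (u3e.symm.trans ((congrFun h 3).trans v3e))
    · fin_cases j
      exacts [Or.inr (u0z.trans v0z.symm), Or.inr (u1z.trans v1z.symm), Or.inl (by decide), Or.inl (by decide), Or.inl (by decide), Or.inl (by decide)]
  have uv2 := uvN 2 (by decide)
  have uv4 := uvN 4 (by decide)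
  have uv5 := uvN 5 (by decide)
  obtain ⟨σ1, hσ1, hσ1'⟩ := exists_aut (z := a) (w := c) z1 w1 zw1
    (by decide) (by decide) (by decide)
  obtain ⟨σ2, hσ2, hσ2'⟩ := exists_aut (z := a) (w := b) u2 v2 uv2
    (by decide) (by decide) (by decide)
  obtain ⟨σ3, hσ3, hσ3'⟩ := exists_aut (z := a) (w := c) x3 y3 xy3
    (by decide) (by decide) (by decide)
  obtain ⟨σ4, hσ4, hσ4'⟩ := exists_aut (z := c) (w := a) x4 y4 xy4
    (by decide) (by decide) (by decide)
  obtain ⟨σ5, hσ5, hσ5'⟩ := exists_aut (z := c) (w := b) x5 y5 xy5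
    (by decide) (by decide) (by decide)
  let σ : Fin 6 → (K ≃+ K) := ![AddEquiv.refl K, σ1, σ2, σ3, σ4, σ5]
  have hS : ∀ {f g : Fin 6 → K}, f ∈ C → g ∈ C →
      scalarProduct (relabel (Equiv.refl _) σ f) (relabel (Equiv.refl _) σ g) = 0 := by
    intro f g hf hg
    rw [scalarProduct_relabel, hC.scalarProduct_eq_zero hf hg]
  have Rx : relabel (Equiv.refl _) σ x = ![a, 0, 0, a, c, c] := by
    funext j
    fin_cases j
    exacts [x0e, (congrArg σ1 x1z).trans (map_zero σ1), (congrArg σ2 x2z).trans (map_zero σ2),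
      hσ3, hσ4, hσ5]
  have Ry : relabel (Equiv.refl _) σ y = ![b, 0, 0, c, a, b] := by
    funext j
    fin_cases j
    exacts [y0e, (congrArg σ1 y1z).trans (map_zero σ1), (congrArg σ2 y2z).trans (map_zero σ2),
      hσ3', hσ4', hσ5']
  have Rz : relabel (Equiv.refl _) σ z = ![0, a, 0, a, σ4 (z 4), σ5 (z 5)] := by
    funext j
    fin_cases j
    exacts [z0z, hσ1, (congrArg σ2 z2z).trans (map_zero σ2),
      (congrArg σ3 z3e).trans hσ3, rfl, rfl]
  have Rw : relabel (Equiv.refl _) σ w = ![0, c, 0, c, σ4 (w 4), σ5 (w 5)] := by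
    funext j
    fin_cases j
    exacts [w0z, hσ1', (congrArg σ2 w2z).trans (map_zero σ2),
      (congrArg σ3 w3e).trans hσ3', rfl, rfl]
  have Ru : relabel (Equiv.refl _) σ u = ![0, 0, a, a, σ4 (u 4), σ5 (u 5)] := by
    funext j
    fin_cases j
    exacts [u0z, (congrArg σ1 u1z).trans (map_zero σ1), hσ2,
      (congrArg σ3 u3e).trans hσ3, rfl, rfl]
  have Rv : relabel (Equiv.refl _) σ v = ![0, 0, b, c, σ4 (v 4), σ5 (v 5)] := by
    funext j
    fin_cases j
    exacts [v0z, (congrArg σ1 v1z).trans (map_zero σ1), hσ2',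
      (congrArg σ3 v3e).trans hσ3', rfl, rfl]
  -- Orthogonality to `x` and `y` leaves two possibilities for the last two entries, and the same
  -- two for `u, v` below.
  have hzw : (σ4 (z 4), σ5 (z 5), σ4 (w 4), σ5 (w 5)) = (b, b, c, a) ∨
      (σ4 (z 4), σ5 (z 5), σ4 (w 4), σ5 (w 5)) = (a, a, b, c) := by
    have h1 := hS hz hx
    have h2 := hS hz hy
    have h3 := hS hw hx
    have h4 := hS hw hy
    rw [Rz] at h1 h2
    rw [Rw] at h3 h4
    rw [Rx] at h1 h3
    rw [Ry] at h2 h4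
    have h := And.intro (And.intro h1 h2) (And.intro h3 h4)
    have h' := And.intro (σ4.injective.ne zw4) (σ5.injective.ne zw5)
    have n1 := And.intro (σ4.map_ne_zero_iff.2 z4) (σ5.map_ne_zero_iff.2 z5)
    have n2 := And.intro (σ4.map_ne_zero_iff.2 w4) (σ5.map_ne_zero_iff.2 w5)
    clear h1 h2 h3 h4
    revert h h' n1 n2
    generalize σ4 (z 4) = p
    generalize σ5 (z 5) = q
    generalize σ4 (w 4) = r
    generalize σ5 (w 5) = s
    revert p q r s
    decide +kernel
  have huv : (σ4 (u 4), σ5 (u 5), σ4 (v 4), σ5 (v 5)) = (a, a, b, c) ∨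
      (σ4 (u 4), σ5 (u 5), σ4 (v 4), σ5 (v 5)) = (b, b, c, a) := by
    have h1 := hS hu hx
    have h2 := hS hu hy
    have h3 := hS hv hx
    have h4 := hS hv hy
    rw [Ru] at h1 h2
    rw [Rv] at h3 h4
    rw [Rx] at h1 h3
    rw [Ry] at h2 h4
    have h := And.intro (And.intro h1 h2) (And.intro h3 h4)
    have h' := And.intro (σ4.injective.ne uv4) (σ5.injective.ne uv5)
    have n1 := And.intro (σ4.map_ne_zero_iff.2 u4) (σ5.map_ne_zero_iff.2 u5)
    have n2 := And.intro (σ4.map_ne_zero_iff.2 v4) (σ5.map_ne_zero_iff.2 v5)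
    clear h1 h2 h3 h4
    revert h h' n1 n2
    generalize σ4 (u 4) = p
    generalize σ5 (u 5) = q
    generalize σ4 (v 4) = r
    generalize σ5 (v 5) = s
    revert p q r s
    decide +kernel
  simp only [Prod.mk.injEq] at hzw huv
  have hzv := hS hz hv
  rw [Rz, Rv] at hzv
  rw [hexacode_eq_range]
  rcases hzw with ⟨e1, e2, e3, e4⟩ | ⟨e1, e2, e3, e4⟩ <;>
    rcases huv with ⟨e5, e6, e7, e8⟩ | ⟨e5, e6, e7, e8⟩ <;>
    rw [e1, e2, e7, e8] at hzv <;>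
    rw [e1, e2] at Rz <;> rw [e3, e4] at Rw <;> rw [e5, e6] at Ru <;> rw [e7, e8] at Rv
  · refine hC.equivalent_range_encode encode_hexacodeBasis_injective (Equiv.refl _) σ ?_
    intro i
    fin_cases i
    exacts [⟨x, hx, Rx⟩, ⟨y, hy, Ry⟩, ⟨z, hz, Rz⟩, ⟨w, hw, Rw⟩, ⟨u, hu, Ru⟩, ⟨v, hv, Rv⟩]
  -- If both pairs took the same possibility, `z` and `v` would not be orthogonal.
  · exact absurd hzv (by decide +kernel)
  · exact absurd hzv (by decide +kernel)
  -- Exchanging the last two positions, and `a` with `b` there, fixes the normalised `x` and `y` and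
  -- interchanges the two possibilities, which reduces this case to the basis words.
  · let e : Fin 6 ≃ Fin 6 := Equiv.swap 4 5
    let t : K ≃+ K := autOfPerm (Equiv.swap a b) (by decide)
    let τ : Fin 6 → (K ≃+ K) := ![AddEquiv.refl K, AddEquiv.refl K, AddEquiv.refl K,
      AddEquiv.refl K, t, t]
    have key : ∀ f, relabel e (fun j => (σ (e j)).trans (τ j)) f =
        relabel e τ (relabel (Equiv.refl _) σ f) := fun _ => rfl
    refine hC.equivalent_range_encode encode_hexacodeBasis_injective e
      (fun j => (σ (e j)).trans (τ j)) ?_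
    intro i
    fin_cases i
    · exact ⟨x, hx, by rw [key, Rx]; decide +kernel⟩
    · exact ⟨y, hy, by rw [key, Ry]; decide +kernel⟩
    · exact ⟨z, hz, by rw [key, Rz]; decide +kernel⟩
    · exact ⟨w, hw, by rw [key, Rw]; decide +kernel⟩
    · exact ⟨u, hu, by rw [key, Ru]; decide +kernel⟩
    · exact ⟨v, hv, by rw [key, Rv]; decide +kernel⟩

end IsOptimal

end Kleinian

theorem theorem12 :
    (Kleinian.IsExtremal Kleinian.gamma1 ∧
      Kleinian.IsExtremal Kleinian.epsilon2 ∧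
      Kleinian.IsExtremal Kleinian.delta3Plus ∧
      Kleinian.IsExtremal Kleinian.shorterHexacode ∧
      Kleinian.IsExtremal Kleinian.hexacode) ∧
    ([⟨1, Kleinian.gamma1⟩, ⟨2, Kleinian.epsilon2⟩, ⟨3, Kleinian.delta3Plus⟩,
        ⟨5, Kleinian.shorterHexacode⟩, ⟨6, Kleinian.hexacode⟩] :
        List (Σ n : ℕ, Kleinian.Code n)).Pairwise
      (fun C D => ¬ Kleinian.Equivalent C.2 D.2) ∧
    ∀ (n : ℕ), 1 ≤ n → ∀ C : Kleinian.Code n, Kleinian.IsExtremal C →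
      Kleinian.Equivalent C Kleinian.gamma1 ∨
      Kleinian.Equivalent C Kleinian.epsilon2 ∨
      Kleinian.Equivalent C Kleinian.delta3Plus ∨
      Kleinian.Equivalent C Kleinian.shorterHexacode ∨
      Kleinian.Equivalent C Kleinian.hexacode := by
  refine ⟨⟨Kleinian.isExtremal_gamma1, Kleinian.isExtremal_epsilon2,
    Kleinian.isExtremal_delta3Plus, Kleinian.isExtremal_shorterHexacode,
    Kleinian.isExtremal_hexacode⟩, ?_, ?_⟩
  · have h : ([⟨1, Kleinian.gamma1⟩, ⟨2, Kleinian.epsilon2⟩, ⟨3, Kleinian.delta3Plus⟩,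
        ⟨5, Kleinian.shorterHexacode⟩, ⟨6, Kleinian.hexacode⟩] :
        List (Σ n : ℕ, Kleinian.Code n)).Pairwise (fun C D => C.1 ≠ D.1) := by
      simp
    exact h.imp fun hne he => hne he.length_eq
  · intro n hn C hC
    rcases hC.length_mem hn with rfl | rfl | rfl | rfl | rfl
    · exact Or.inl hC.isOptimal.equivalent_gamma1
    · exact Or.inr (Or.inl hC.isOptimal.equivalent_epsilon2)
    · exact Or.inr (Or.inr (Or.inl hC.isOptimal.equivalent_delta3Plus))
    · exact Or.inr (Or.inr (Or.inr (Or.inl hC.isOptimal.equivalent_shorterHexacode)))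
    · exact Or.inr (Or.inr (Or.inr (Or.inr hC.isOptimal.equivalent_hexacode)))
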